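/- For real $\lambda>-1/2$ and $\nu\ge 0$ let $${}^{r}G_\nu^{(\lambda)}(x)={}_2F_1\Big(-\nu,\nu+2\lambda;\lambda+\tfrac12;\tfrac{1-x}{2}\Big),\qquad x\in(-1,1),$$ be the right generalised Gegenbauer function of degree $\nu$. For $\varphi\in(0,\pi)$ and $t>0$ put $$g(\varphi,t)=\frac{\cos(\varphi-\mathrm i t)-\cos\varphi}{t},\qquad g(\varphi,0)=\lim_{t\to0^+}g(\varphi,t)=\mathrm i\sin\varphi,\qquad f^{(\lambda)}(\varphi,t)=\frac{g(\varphi,t)^{\lambda-1}-g(\varphi,0)^{\lambda-1}}{t},$$ with principal powers. **Theorem.** Let $\lambda>0$, $\nu\ge 0$ and $\varphi\in(0,\pi)$. Then $$(\sin\varphi)^{\lambda}\,{}^{r}G_\nu^{(\lambda)}(\cos\varphi)=\frac{2^\lambda\Gamma(\lambda+1/2)}{\sqrt\pi\,(\nu+\lambda)^\lambda}\cos\big((\nu+\lambda)\varphi-\lambda\pi/2\big)+\mathcal R_\nu^{(\lambda)}(\varphi),$$ where $$\mathcal R_\nu^{(\lambda)}(\varphi)=\frac{2^\lambda\Gamma(\lambda+1/2)}{\sqrt\pi\,\Gamma(\lambda)}(\sin\varphi)^{1-\lambda}\int_0^\infty\Re\big\{\mathrm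 i\,e^{-\mathrm i(\nu+\lambda)\varphi}f^{(\lambda)}(\varphi,t)\big\}\,t^\lambda e^{-(\nu+\lambda)t}\,dt,$$ and the integral converges absolutely. Moreover $|\mathcal R_\nu^{(\lambda)}(\varphi)|\le\mathcal S_\nu^{(\lambda)}(\varphi)$ in each of the following two cases: (i) if $0<\lambda\le2$, $\nu+\lambda>1$ and $\nu>0$, with $$\mathcal S_\nu^{(\lambda)}(\varphi)=\frac{\lambda|\lambda-1|2^\lambda\Gamma(\lambda+1/2)}{\sqrt\pi\,(\nu+\lambda-1)^{\lambda+1}}\Big\{|\cot\varphi|+\frac23\,\frac{\lambda+1}{\nu+\lambda-1}\Big\};$$ (ii) if $\lambda>2$, $\nu>\lambda-3$ and $\nu>0$, with $$\mathcal S_\nu^{(\lambda)}(\varphi)=\frac{\lambda(\lambda-1)2^{3\lambda/2}\Gamma(\lambda+1/2)}{\sqrt\pi\,(\nu+1)^{\lambda+1}}\Big\{|\cot\varphi|+\frac23\,\frac{\lambda+1}{\nu+1}+\frac{2^{2-\lambda}\Gamma(2\lambda-1)}{\Gamma(\lambda+1)}\,\frac{(\nu+1)^{\lambda+1}}{(\nu-\lambda+3)^{2\lambda-1}}|\cot\varphi|^{\lambda-2}\Big(|\cot\varphi|+\frac23\,\frac{2\lambda-1}{\nu-\lambda+3}\Big)\Big\}.$$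 -/

import Mathlib

/-- The right generalised Gegenbauer function of fractional degree `ν`,
`₂F₁(-ν, ν + 2 lam; lam + 1/2; (1 - x) / 2)`, for `x ∈ (-1, 1)`, `lam > -1/2`, `ν ≥ 0`. -/
noncomputable def rightGGF (lam ν x : ℝ) : ℝ :=
  ordinaryHypergeometric (-ν) (ν + 2 * lam) (lam + 1 / 2) ((1 - x) / 2)

/-- `g(φ, t) = (cos (φ - i t) - cos φ) / t` for `t ≠ 0`, extended by its limit
`g(φ, 0) = i sin φ` (see `ggfG_tendsto`). -/
noncomputable def ggfG (φ t : ℝ) : ℂ :=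
  if t = 0 then Complex.I * (Real.sin φ : ℂ)
  else (Complex.cos ((φ : ℂ) - Complex.I * (t : ℂ)) - Complex.cos (φ : ℂ)) / (t : ℂ)

/-- The value of `ggfG φ` at `0` is the limit of its values as `t → 0+`. -/
theorem ggfG_tendsto (φ : ℝ) :
    Filter.Tendsto (ggfG φ) (nhdsWithin 0 (Set.Ioi 0)) (nhds (ggfG φ 0)) := by
  have h1 : HasDerivAt (fun t : ℝ => (φ : ℂ) - Complex.I * (t : ℂ)) (-Complex.I) 0 := by
    have h := ((Complex.ofRealCLM.hasDerivAt (x := (0 : ℝ))).const_mul Complex.I).const_sub (φ : ℂ)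
    simpa using h
  have h2 : HasDerivAt (fun t : ℝ => Complex.cos ((φ : ℂ) - Complex.I * (t : ℂ)))
      (Complex.I * (Real.sin φ : ℂ)) 0 := by
    have h := HasDerivAt.comp (0 : ℝ) (Complex.hasDerivAt_cos ((φ : ℂ) - Complex.I * ((0 : ℝ) : ℂ))) h1
    refine h.congr_deriv ?_
    simp [mul_comm]
  have h3 := (hasDerivAt_iff_tendsto_slope_zero.1 h2).mono_left
    (nhdsWithin_mono (0 : ℝ) (fun t (ht : 0 < t) => ne_of_gt ht))
  have h0 : ggfG φ 0 = Complex.I * (Real.sin φ : ℂ) := by simp [ggfG]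
  rw [h0]
  refine h3.congr' ?_
  filter_upwards [self_mem_nhdsWithin] with t ht
  have ht' : t ≠ 0 := ne_of_gt ht
  simp [ggfG, ht', div_eq_inv_mul]

/-- `f^(lam)(φ, t) = (g(φ, t)^(lam - 1) - g(φ, 0)^(lam - 1)) / t`, with principal powers
(for `φ ∈ (0, π)` and `t ≥ 0` the number `g(φ, t)` lies in the open upper half plane). -/
noncomputable def ggfF (lam φ t : ℝ) : ℂ :=
  (ggfG φ t ^ ((lam : ℂ) - 1) - ggfG φ 0 ^ ((lam : ℂ) - 1)) / (t : ℂ)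

/-- `Re {i e^{-i (ν + lam) φ} f^(lam)(φ, t)} t^lam e^{-(ν + lam) t}`. -/
noncomputable def ggfResidualIntegrand (lam ν φ t : ℝ) : ℝ :=
  (Complex.I * Complex.exp (-(Complex.I * ((ν : ℂ) + (lam : ℂ)) * (φ : ℂ))) * ggfF lam φ t).re
    * t ^ lam * Real.exp (-((ν + lam) * t))

/-- The residual term, as an integral over `(0, ∞)`. -/
noncomputable def ggfResidual (lam ν φ : ℝ) : ℝ :=
  2 ^ lam * Real.Gamma (lam + 1 / 2) / (Real.sqrt Real.pi * Real.Gamma lam)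
    * Real.sin φ ^ (1 - lam)
    * ∫ t in Set.Ioi (0 : ℝ), ggfResidualIntegrand lam ν φ t

/-- The bound for the residual in the case `0 < lam ≤ 2`, `ν + lam > 1`. -/
noncomputable def ggfBoundSmall (lam ν φ : ℝ) : ℝ :=
  lam * |lam - 1| * 2 ^ lam * Real.Gamma (lam + 1 / 2)
      / (Real.sqrt Real.pi * (ν + lam - 1) ^ (lam + 1))
    * (|Real.cot φ| + 2 / 3 * ((lam + 1) / (ν + lam - 1)))

/-- The bound for the residual in the case `lam > 2`, `ν > lam - 3`. -/
noncomputable def ggfBoundLarge (lam ν φ : ℝ) : ℝ :=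
  lam * (lam - 1) * 2 ^ (3 * lam / 2) * Real.Gamma (lam + 1 / 2)
      / (Real.sqrt Real.pi * (ν + 1) ^ (lam + 1))
    * (|Real.cot φ| + 2 / 3 * ((lam + 1) / (ν + 1))
      + 2 ^ (2 - lam) * Real.Gamma (2 * lam - 1) / Real.Gamma (lam + 1)
        * ((ν + 1) ^ (lam + 1) / (ν - lam + 3) ^ (2 * lam - 1))
        * |Real.cot φ| ^ (lam - 2)
        * (|Real.cot φ| + 2 / 3 * ((2 * lam - 1) / (ν - lam + 3))))

/-- The bound `S` for the residual: the two cases combined. -/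
noncomputable def ggfBound (lam ν φ : ℝ) : ℝ :=
  if lam ≤ 2 then ggfBoundSmall lam ν φ else ggfBoundLarge lam ν φ

/-!
Put `N = ν + lam` and `z = sin² (φ / 2) = (1 - cos φ) / 2`. The proof rests on the Mehler–Dirichlet
formula: up to the factor `√π Γ(lam) / (2^lam Γ(lam + 1/2))`, the number
`(sin φ)^(2 lam - 1) rightGGF lam ν (cos φ)` is the integral of
`cos (N θ) (cos θ - cos φ)^(lam - 1)` over `0 < θ < φ` (`integral_cos_mul_cos_sub_cos_rpow`).
It follows from `cos (N θ) = cos (θ / 2) ₂F₁(1/2 + N, 1/2 - N; 1/2; sin² (θ / 2))`, termwise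
integration of the hypergeometric series after the substitution `s = sin² (θ / 2)`
(`integral_rpow_mul_ordinaryHypergeometric`), and Euler's transformation of `₂F₁`
(`ordinaryHypergeometric_euler`), all of which come from the hypergeometric differential equation.

The integral is the real part of the integral of `e^{-i N θ} (cos θ - cos φ)^(lam - 1)`. This
function is holomorphic in the half-strip `0 < re θ < φ`, `im θ < 0` and decays there, so the path
may be replaced by the two vertical half-lines. On `θ = -i t` the function is real and
`dθ = -i dt`, so nothing is contributed to the real part; the half-line `θ = φ - i t` gives the
integral of `re (i e^{-i N φ} (t g(φ, t))^(lam - 1)) e^{-N t}` (`re_integral_mehlerKernel`).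
Replacing `g(φ, t)` by `g(φ, 0) = i sin φ` leaves a gamma integral, which is the cosine term of the
formula, and the difference is the residual.

For the bounds, write `w = g(φ, t) / g(φ, 0) = sinh t / t - i cot φ (cosh t - 1) / t`. As
`re w ≥ 1`, the mean value inequality on the half-plane `re z ≥ 1` bounds `|w^(lam - 1) - 1|` by
`|lam - 1| |w - 1|` times `1` if `lam ≤ 2`, and times `|w|^(lam - 2)` if `lam > 2`. With
`|w - 1| ≤ t (|cot φ| + 2 t / 3) e^t` and `|w|² ≤ e^(2 t) (1 + (t cot φ / 2)²)` the residual is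
majorised by gamma integrals.
-/

/-! ### The Gauss hypergeometric series -/

/-- The two-term recursion of the hypergeometric coefficients, with denominators cleared. -/
theorem ordinaryHypergeometricCoefficient_succ (a b c : ℝ) (hc : 0 < c) (n : ℕ) :
    ordinaryHypergeometricCoefficient a b c (n + 1) * (((n : ℝ) + 1) * (c + n)) =
      (a + n) * (b + n) * ordinaryHypergeometricCoefficient a b c n := by
  have h1 : (ascPochhammer ℝ n).eval c ≠ 0 := (ascPochhammer_pos n c hc).ne'
  have h2 : c + n ≠ 0 := by positivity
  have h3 : (n : ℝ) + 1 ≠ 0 := by positivity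
  have h4 : (n.factorial : ℝ) ≠ 0 := by positivity
  simp only [ordinaryHypergeometricCoefficient, ascPochhammer_succ_eval, Nat.factorial_succ]
  push_cast
  field_simp

/-- The coefficients of the derivative of a hypergeometric series. -/
theorem succ_mul_ordinaryHypergeometricCoefficient_succ (a b c : ℝ) (hc : 0 < c) (n : ℕ) :
    ((n : ℝ) + 1) * ordinaryHypergeometricCoefficient a b c (n + 1) =
      a * b / c * ordinaryHypergeometricCoefficient (a + 1) (b + 1) (c + 1) n := by
  have h3 : (n : ℝ) + 1 ≠ 0 := by positivity
  have h4 : (n.factorial : ℝ) ≠ 0 := by positivity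
  have h5 : (ascPochhammer ℝ n).eval (c + 1) ≠ 0 := (ascPochhammer_pos n _ (by positivity)).ne'
  have key (x : ℝ) : (ascPochhammer ℝ (n + 1)).eval x = x * (ascPochhammer ℝ n).eval (x + 1) := by
    simp [ascPochhammer_succ_left]
  simp only [ordinaryHypergeometricCoefficient, key, Nat.factorial_succ]
  push_cast
  field_simp

/-- If `a` or `b` is a nonpositive integer the series terminates and its radius is infinite;
otherwise the radius is `1`. -/
theorem one_le_radius_ordinaryHypergeometricSeries (a b c : ℝ) (hc : 0 < c) :
    1 ≤ (ordinaryHypergeometricSeries ℝ a b c).radius := by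
  by_cases h : ∀ k : ℕ, (k : ℝ) ≠ -a ∧ (k : ℝ) ≠ -b ∧ (k : ℝ) ≠ -c
  · exact (ordinaryHypergeometricSeries_radius_eq_one ℝ a b c h).ge
  · push Not at h
    obtain ⟨k, hk⟩ := h
    by_cases ha : (k : ℝ) = -a
    · obtain rfl : a = -(k : ℝ) := by linarith
      rw [ordinaryHypergeometric_radius_top_of_neg_nat₁]; exact le_top
    · by_cases hb : (k : ℝ) = -b
      · obtain rfl : b = -(k : ℝ) := by linarith
        rw [ordinaryHypergeometric_radius_top_of_neg_nat₂]; exact le_top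
      · have := hk ha hb
        have : (0 : ℝ) ≤ k := Nat.cast_nonneg k
        linarith

theorem hasFPowerSeriesOnBall_ordinaryHypergeometric (a b c : ℝ) (hc : 0 < c) :
    HasFPowerSeriesOnBall (ordinaryHypergeometric a b c : ℝ → ℝ)
      (ordinaryHypergeometricSeries ℝ a b c) 0 1 :=
  ((ordinaryHypergeometricSeries ℝ a b c).hasFPowerSeriesOnBall
    (lt_of_lt_of_le one_pos (one_le_radius_ordinaryHypergeometricSeries a b c hc))).mono one_pos
    (one_le_radius_ordinaryHypergeometricSeries a b c hc)

theorem hasSum_ordinaryHypergeometric (a b c : ℝ) (hc : 0 < c) {z : ℝ} (hz : |z| < 1) :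
    HasSum (fun n => ordinaryHypergeometricCoefficient a b c n * z ^ n)
      (ordinaryHypergeometric a b c z) := by
  have h := (hasFPowerSeriesOnBall_ordinaryHypergeometric a b c hc).hasSum (y := z)
    (by simpa [enorm_eq_nnnorm, ← NNReal.coe_lt_coe] using hz)
  simpa [ordinaryHypergeometricSeries, FormalMultilinearSeries.ofScalars_apply_eq, mul_comm,
    mul_left_comm] using h

theorem summable_abs_ordinaryHypergeometricCoefficient (a b c : ℝ) (hc : 0 < c) {r : ℝ}
    (hr0 : 0 ≤ r) (hr : r < 1) :
    Summable (fun n => |ordinaryHypergeometricCoefficient a b c n| * r ^ n) := by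
  have h := (hasSum_ordinaryHypergeometric a b c hc (z := r) (by rwa [abs_of_nonneg hr0])).summable
  refine h.abs.congr fun n => ?_
  rw [abs_mul, abs_of_nonneg (pow_nonneg hr0 n)]

theorem analyticAt_ordinaryHypergeometric (a b c : ℝ) (hc : 0 < c) {z : ℝ} (hz : |z| < 1) :
    AnalyticAt ℝ (ordinaryHypergeometric a b c : ℝ → ℝ) z :=
  (hasFPowerSeriesOnBall_ordinaryHypergeometric a b c hc).analyticAt_of_mem
    (by simpa [edist_dist, Real.dist_eq] using hz)

theorem hasDerivAt_ordinaryHypergeometric (a b c : ℝ) (hc : 0 < c) {z : ℝ} (hz : |z| < 1) :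
    HasDerivAt (ordinaryHypergeometric a b c : ℝ → ℝ)
      (a * b / c * ordinaryHypergeometric (a + 1) (b + 1) (c + 1) z) z := by
  obtain ⟨r, hzr, hr1⟩ := exists_between hz
  have hr0 : 0 < r := (abs_nonneg z).trans_lt hzr
  set u := ordinaryHypergeometricCoefficient a b c with hu
  set v := ordinaryHypergeometricCoefficient (a + 1) (b + 1) (c + 1) with hv
  have huv (n : ℕ) : ((n : ℝ) + 1) * u (n + 1) = a * b / c * v n :=
    succ_mul_ordinaryHypergeometricCoefficient_succ a b c hc n
  have hsum := (summable_abs_ordinaryHypergeometricCoefficient (a + 1) (b + 1) (c + 1)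
    (by positivity) hr0.le hr1).mul_left |a * b / c|
  have hbound : Summable (fun n : ℕ => |(n : ℝ) * u n| * r ^ (n - 1)) := by
    rw [← summable_nat_add_iff 1]
    refine hsum.congr fun n => ?_
    simp only [Nat.cast_add, Nat.cast_one, huv, abs_mul, Nat.add_sub_cancel, hv]
    ring
  have hfun : (ordinaryHypergeometric a b c : ℝ → ℝ) = fun y => ∑' n, u n * y ^ n := by
    ext y
    simp [ordinaryHypergeometric_eq_tsum, hu, ordinaryHypergeometricCoefficient]
  rw [hfun]
  have hd := hasDerivAt_tsum_of_isPreconnected (𝕜 := ℝ) (t := Metric.ball 0 r) (y₀ := 0) (y := z)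
    (g := fun n y => u n * y ^ n) (g' := fun n y => u n * (n * y ^ (n - 1))) hbound
    Metric.isOpen_ball (convex_ball 0 r).isPreconnected
    (fun n y _ => (hasDerivAt_pow n y).const_mul (u n))
    (fun n y hy => by
      have hy' : |y| ≤ r := by simpa using (Metric.mem_ball.1 hy).le
      rw [Real.norm_eq_abs, show u n * (n * y ^ (n - 1)) = (n * u n) * y ^ (n - 1) by ring, abs_mul,
        abs_pow]
      gcongr)
    (Metric.mem_ball_self hr0)
    (hasSum_ordinaryHypergeometric a b c hc (z := 0) (by simp)).summable
    (by simpa using hzr)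
  refine hd.congr_deriv ?_
  have h1 := (hasSum_ordinaryHypergeometric (a + 1) (b + 1) (c + 1) (by positivity) hz).mul_left
    (a * b / c)
  rw [← h1.tsum_eq, tsum_eq_zero_add']
  · simp only [Nat.cast_zero, zero_mul, mul_zero, zero_add, Nat.cast_add, Nat.cast_one,
      Nat.add_sub_cancel]
    refine tsum_congr fun n => ?_
    linear_combination z ^ n * huv n
  · refine h1.summable.congr fun n => ?_
    simp only [Nat.cast_add, Nat.cast_one, Nat.add_sub_cancel]
    linear_combination -z ^ n * huv n

/-- The hypergeometric differential equation, with the first two derivatives written as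
contiguous hypergeometric functions. -/
theorem ordinaryHypergeometric_ode (a b c : ℝ) (hc : 0 < c) {z : ℝ} (hz : |z| < 1) :
    z * (1 - z) * (a * b / c * ((a + 1) * (b + 1) / (c + 1) *
        ordinaryHypergeometric (a + 1 + 1) (b + 1 + 1) (c + 1 + 1) z))
      + (c - (a + b + 1) * z) * (a * b / c * ordinaryHypergeometric (a + 1) (b + 1) (c + 1) z)
      - a * b * ordinaryHypergeometric a b c z = 0 := by
  have hc1 : 0 < c + 1 := by positivity
  have hc2 : 0 < c + 1 + 1 := by positivity
  set u := ordinaryHypergeometricCoefficient a b c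
  have r0 (n : ℕ) := ordinaryHypergeometricCoefficient_succ a b c hc n
  have r1 (n : ℕ) := succ_mul_ordinaryHypergeometricCoefficient_succ a b c hc n
  have r2 (n : ℕ) := succ_mul_ordinaryHypergeometricCoefficient_succ (a + 1) (b + 1) (c + 1) hc1 n
  have s0 := hasSum_ordinaryHypergeometric a b c hc hz
  have s1 : HasSum (fun n : ℕ => ((n : ℝ) + 1) * u (n + 1) * z ^ n)
      (a * b / c * ordinaryHypergeometric (a + 1) (b + 1) (c + 1) z) := by
    refine ((hasSum_ordinaryHypergeometric (a + 1) (b + 1) (c + 1) hc1 hz).mul_left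
      (a * b / c)).congr_fun fun n => ?_
    linear_combination z ^ n * r1 n
  have s2 : HasSum (fun n : ℕ => ((n : ℝ) + 1) * (n + 2) * u (n + 2) * z ^ n)
      (a * b / c * ((a + 1) * (b + 1) / (c + 1) *
        ordinaryHypergeometric (a + 1 + 1) (b + 1 + 1) (c + 1 + 1) z)) := by
    refine (((hasSum_ordinaryHypergeometric (a + 1 + 1) (b + 1 + 1) (c + 1 + 1) hc2 hz).mul_left
      ((a + 1) * (b + 1) / (c + 1))).mul_left (a * b / c)).congr_fun fun n => ?_
    have := r1 (n + 1)
    push_cast at this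
    linear_combination (a * b / c) * z ^ n * r2 n + (n + 1) * z ^ n * this
  -- Multiplying by `z` shifts the index; the shifted series start with a vanishing term.
  have t1 : HasSum (fun n : ℕ => (n : ℝ) * u n * z ^ n)
      (z * (a * b / c * ordinaryHypergeometric (a + 1) (b + 1) (c + 1) z)) := by
    rw [← hasSum_nat_add_iff' 1]
    simp only [Finset.range_one, Finset.sum_singleton, Nat.cast_zero, zero_mul, sub_zero]
    refine (s1.mul_left z).congr_fun fun n => ?_
    push_cast; ring
  have t2 : HasSum (fun n : ℕ => (n : ℝ) * (n + 1) * u (n + 1) * z ^ n)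
      (z * (a * b / c * ((a + 1) * (b + 1) / (c + 1) *
        ordinaryHypergeometric (a + 1 + 1) (b + 1 + 1) (c + 1 + 1) z))) := by
    rw [← hasSum_nat_add_iff' 1]
    simp only [Finset.range_one, Finset.sum_singleton, Nat.cast_zero, zero_mul, sub_zero]
    refine (s2.mul_left z).congr_fun fun n => ?_
    push_cast; ring
  have t3 : HasSum (fun n : ℕ => ((n : ℝ) - 1) * n * u n * z ^ n)
      (z * (z * (a * b / c * ((a + 1) * (b + 1) / (c + 1) *
        ordinaryHypergeometric (a + 1 + 1) (b + 1 + 1) (c + 1 + 1) z)))) := by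
    rw [← hasSum_nat_add_iff' 1]
    simp only [Finset.range_one, Finset.sum_singleton, Nat.cast_zero, zero_mul, mul_zero, sub_zero]
    refine (t2.mul_left z).congr_fun fun n => ?_
    push_cast; ring
  have total := (((t2.sub t3).add (s1.mul_left c)).sub (t1.mul_left (a + b + 1))).sub
    (s0.mul_left (a * b))
  have hz0 : HasSum (fun _ : ℕ => (0 : ℝ)) 0 := hasSum_zero
  have := total.unique (hz0.congr_fun fun n => ?_)
  · linear_combination this
  · linear_combination z ^ n * r0 n

/-- An analytic solution of an equation `z p h'' + q h' + r h = 0` with `p 0 = 1`, `q 0 > 0` that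
vanishes at `0` vanishes near `0`: if `h = z ^ n g` with `g 0 ≠ 0` and `n ≥ 1`, the lowest-order
term of the equation is `n (n - 1 + q 0) g 0 ≠ 0`. -/
theorem eventually_eq_zero_of_fuchsian_ode {h p q r : ℝ → ℝ} (hh : AnalyticAt ℝ h 0)
    (hp : ContinuousAt p 0) (hq : ContinuousAt q 0) (hr : ContinuousAt r 0) (hp0 : p 0 = 1)
    (hq0 : 0 < q 0) (h0 : h 0 = 0)
    (ode : ∀ᶠ z in nhds 0, z * p z * deriv (deriv h) z + q z * deriv h z + r z * h z = 0) :
    ∀ᶠ z in nhds 0, h z = 0 := by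
  by_contra hne
  obtain ⟨n, g, hg, hg0, heq⟩ := hh.exists_eventuallyEq_pow_smul_nonzero_iff.2 hne
  simp only [sub_zero, smul_eq_mul] at heq
  obtain _ | m := n
  · apply hg0
    simpa [h0] using heq.self_of_nhds.symm
  have hgd : AnalyticAt ℝ (deriv g) 0 := hg.deriv
  have hgdd : AnalyticAt ℝ (deriv (deriv g)) 0 := hgd.deriv
  have d1 : ∀ᶠ z in nhds 0, deriv h z = (m + 1) * z ^ m * g z + z ^ (m + 1) * deriv g z := by
    filter_upwards [heq.eventually_nhds, hg.eventually_analyticAt] with z hz hgz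
    rw [Filter.EventuallyEq.deriv_eq (f := fun y => y ^ (m + 1) * g y) hz]
    have := (hasDerivAt_pow (m + 1) z).mul hgz.differentiableAt.hasDerivAt
    rw [HasDerivAt.deriv (f := fun y => y ^ (m + 1) * g y) this]
    push_cast
    simp
  have d2 : ∀ᶠ z in nhds 0, z * deriv (deriv h) z = z ^ m * ((m + 1) * m * g z
      + 2 * (m + 1) * z * deriv g z + z ^ 2 * deriv (deriv g) z) := by
    filter_upwards [d1.eventually_nhds, hg.eventually_analyticAt, hgd.eventually_analyticAt]
      with z hz hgz hgdz
    rw [Filter.EventuallyEq.deriv_eq hz]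
    have e1 := (((hasDerivAt_pow m z).const_mul ((m : ℝ) + 1)).mul
      hgz.differentiableAt.hasDerivAt).add
      ((hasDerivAt_pow (m + 1) z).mul hgdz.differentiableAt.hasDerivAt)
    have e2 := HasDerivAt.deriv (f := fun z => (m + 1) * z ^ m * g z + z ^ (m + 1) * deriv g z) e1
    rw [e2]
    have e3 : z * (m * z ^ (m - 1)) = m * z ^ m := by
      obtain _ | k := m
      · simp
      · simp; ring
    push_cast
    linear_combination (m + 1) * g z * e3
  -- `K` is the left-hand side of the equation divided by `z ^ m`.
  set K : ℝ → ℝ := fun z => p z * ((m + 1) * m * g z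
      + 2 * (m + 1) * z * deriv g z + z ^ 2 * deriv (deriv g) z)
      + q z * ((m + 1) * g z + z * deriv g z) + r z * (z * g z) with hK
  have hKc : ContinuousAt K 0 := by
    have := hg.continuousAt
    have := hgd.continuousAt
    have := hgdd.continuousAt
    fun_prop
  have hK0 : K 0 = (m + 1) * (m + q 0) * g 0 := by simp [hK, hp0]; ring
  have hKz : ∀ᶠ z in nhdsWithin 0 {0}ᶜ, K z = 0 := by
    filter_upwards [nhdsWithin_le_nhds d1, nhdsWithin_le_nhds d2, nhdsWithin_le_nhds ode,
      nhdsWithin_le_nhds heq, self_mem_nhdsWithin] with z h1 h2 h3 h4 hz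
    have hzm : z ^ m ≠ 0 := pow_ne_zero _ hz
    have : z ^ m * K z = 0 := by
      rw [h1, h4] at h3
      simp only [hK]
      linear_combination h3 - p z * h2
    exact (mul_eq_zero.1 this).resolve_left hzm
  have hlim : Filter.Tendsto K (nhdsWithin 0 {0}ᶜ) (nhds (K 0)) :=
    hKc.tendsto.mono_left nhdsWithin_le_nhds
  have : K 0 = 0 :=
    tendsto_nhds_unique hlim (tendsto_const_nhds.congr' (hKz.mono fun z hz => hz.symm))
  rw [hK0] at this
  have h1 : (m : ℝ) + 1 ≠ 0 := by positivity
  have h2 : (m : ℝ) + q 0 ≠ 0 := by positivity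
  exact (mul_ne_zero (mul_ne_zero h1 h2) hg0) this

/-- Euler's transformation. Both sides solve the same hypergeometric equation near `0` and equal
`1` at `0`; the identity spreads to the unit interval by analyticity. -/
theorem ordinaryHypergeometric_euler (a b c : ℝ) (hc : 0 < c) {z : ℝ} (hz : |z| < 1) :
    (1 - z) ^ (c - a - b) * ordinaryHypergeometric (c - a) (c - b) c z =
      ordinaryHypergeometric a b c z := by
  have hball {y : ℝ} : y ∈ Metric.ball (0 : ℝ) 1 ↔ |y| < 1 := by simp
  have hmem : Metric.ball (0 : ℝ) 1 ∈ nhds 0 := Metric.ball_mem_nhds 0 one_pos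
  set s := c - a - b with hs
  -- `G1`, `G2` and `F1`, `F2` are the first two derivatives of `G` and `F`.
  have hpow (t : ℝ) {y : ℝ} (hy : |y| < 1) :
      HasDerivAt (fun x : ℝ => (1 - x) ^ t) (-(t * (1 - y) ^ (t - 1))) y := by
    have h1 : (1 - y) ≠ 0 := by have := (abs_lt.1 hy).2; linarith
    have := ((hasDerivAt_id y).const_sub 1).rpow_const (p := t) (Or.inl h1)
    refine this.congr_deriv ?_
    simp
  have hpowan {y : ℝ} (hy : |y| < 1) : AnalyticAt ℝ (fun x : ℝ => (1 - x) ^ s) y := by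
    have h1 : 0 < 1 - y := by have := (abs_lt.1 hy).2; linarith
    exact (ContDiffAt.rpow_const_of_ne (n := ⊤) (by fun_prop) h1.ne').analyticAt
  set G : ℝ → ℝ := ordinaryHypergeometric (c - a) (c - b) c with hG
  set F : ℝ → ℝ := ordinaryHypergeometric a b c with hF
  set G1 : ℝ → ℝ := fun y => (c - a) * (c - b) / c *
    ordinaryHypergeometric (c - a + 1) (c - b + 1) (c + 1) y with hG1
  set G2 : ℝ → ℝ := fun y => (c - a) * (c - b) / c * ((c - a + 1) * (c - b + 1) / (c + 1) *
    ordinaryHypergeometric (c - a + 1 + 1) (c - b + 1 + 1) (c + 1 + 1) y) with hG2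
  set F1 : ℝ → ℝ := fun y => a * b / c *
    ordinaryHypergeometric (a + 1) (b + 1) (c + 1) y with hF1
  set F2 : ℝ → ℝ := fun y => a * b / c * ((a + 1) * (b + 1) / (c + 1) *
    ordinaryHypergeometric (a + 1 + 1) (b + 1 + 1) (c + 1 + 1) y) with hF2
  have dG {y : ℝ} (hy : |y| < 1) : HasDerivAt G (G1 y) y :=
    hasDerivAt_ordinaryHypergeometric _ _ _ hc hy
  have dG1 {y : ℝ} (hy : |y| < 1) : HasDerivAt G1 (G2 y) y :=
    (hasDerivAt_ordinaryHypergeometric _ _ _ (by positivity) hy).const_mul _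
  have dF {y : ℝ} (hy : |y| < 1) : HasDerivAt F (F1 y) y :=
    hasDerivAt_ordinaryHypergeometric _ _ _ hc hy
  have dF1 {y : ℝ} (hy : |y| < 1) : HasDerivAt F1 (F2 y) y :=
    (hasDerivAt_ordinaryHypergeometric _ _ _ (by positivity) hy).const_mul _
  set h : ℝ → ℝ := fun y => (1 - y) ^ s * G y - F y with hh
  set h1 : ℝ → ℝ := fun y => -(s * (1 - y) ^ (s - 1)) * G y + (1 - y) ^ s * G1 y - F1 y with hh1
  have dh {y : ℝ} (hy : |y| < 1) : HasDerivAt h (h1 y) y :=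
    ((hpow s hy).mul (dG hy)).sub (dF hy)
  have dh1 {y : ℝ} (hy : |y| < 1) : HasDerivAt h1
      (-(s * -((s - 1) * (1 - y) ^ (s - 1 - 1))) * G y + -(s * (1 - y) ^ (s - 1)) * G1 y
        + (-(s * (1 - y) ^ (s - 1)) * G1 y + (1 - y) ^ s * G2 y) - F2 y) y :=
    (((((hpow (s - 1) hy).const_mul s).neg).mul (dG hy)).add ((hpow s hy).mul (dG1 hy))).sub (dF1 hy)
  have han : AnalyticOnNhd ℝ h (Metric.ball 0 1) := fun y hy =>
    ((hpowan (hball.1 hy)).mul (analyticAt_ordinaryHypergeometric _ _ _ hc (hball.1 hy))).sub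
      (analyticAt_ordinaryHypergeometric _ _ _ hc (hball.1 hy))
  have hdh : ∀ᶠ y in nhds 0, deriv h y = h1 y := by
    filter_upwards [hmem] with y hy using (dh (hball.1 hy)).deriv
  have hloc : ∀ᶠ y in nhds 0, h y = 0 := by
    refine eventually_eq_zero_of_fuchsian_ode (p := fun y => 1 - y)
      (q := fun y => c - (a + b + 1) * y) (r := fun _ => -(a * b))
      (han 0 (Metric.mem_ball_self one_pos)) (by fun_prop) (by fun_prop) (by fun_prop) (by simp)
      (by simpa using hc) (by simp [hh, hG, hF]) ?_
    filter_upwards [hmem, hdh, hdh.eventually_nhds] with y hy e1 e2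
    have hy' := hball.1 hy
    rw [Filter.EventuallyEq.deriv_eq e2, (dh1 hy').deriv, e1]
    have hpos : 0 < 1 - y := by have := (abs_lt.1 hy').2; linarith
    have oG := ordinaryHypergeometric_ode (c - a) (c - b) c hc hy'
    have oF := ordinaryHypergeometric_ode a b c hc hy'
    change y * (1 - y) * G2 y + (c - (c - a + (c - b) + 1) * y) * G1 y
      - (c - a) * (c - b) * G y = 0 at oG
    change y * (1 - y) * F2 y + (c - (a + b + 1) * y) * F1 y - a * b * F y = 0 at oF
    have p1 : (1 - y) ^ (s - 1) = (1 - y) * (1 - y) ^ (s - 1 - 1) := by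
      rw [mul_comm, ← Real.rpow_add_one hpos.ne']; congr 1; ring
    have p2 : (1 - y) ^ s = (1 - y) ^ 2 * (1 - y) ^ (s - 1 - 1) := by
      rw [mul_comm, ← Real.rpow_natCast, ← Real.rpow_add hpos]; congr 1; push_cast; ring
    simp only [hh, hh1]
    rw [p1, p2]
    generalize (1 - y) ^ (s - 1 - 1) = E
    rw [hs]
    linear_combination (1 - y) ^ 2 * E * oG - oF
  have hzero := han.eqOn_of_preconnected_of_eventuallyEq (g := fun _ => 0)
    (fun _ _ => analyticAt_const) (convex_ball 0 1).isPreconnected (Metric.mem_ball_self one_pos)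
    hloc (hball.2 hz)
  have : (1 - z) ^ s * G z - F z = 0 := hzero
  linarith

/-- `cos (N θ)` as a hypergeometric function of `sin² (θ / 2)`: both sides solve `y'' = -N² y` with
the same initial values. -/
theorem cos_half_mul_ordinaryHypergeometric {N θ : ℝ} (hN : 0 < N) (h0 : 0 ≤ θ)
    (hθ : θ < Real.pi) :
    Real.cos (θ / 2) * ordinaryHypergeometric (1 / 2 + N) (1 / 2 - N) (1 / 2 : ℝ)
      (Real.sin (θ / 2) ^ 2) = Real.cos (N * θ) := by
  set F : ℝ → ℝ := ordinaryHypergeometric (1 / 2 + N) (1 / 2 - N) (1 / 2 : ℝ) with hF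
  set F1 : ℝ → ℝ := fun y => (1 / 2 + N) * (1 / 2 - N) / (1 / 2) *
    ordinaryHypergeometric (1 / 2 + N + 1) (1 / 2 - N + 1) (1 / 2 + 1 : ℝ) y with hF1
  set F2 : ℝ → ℝ := fun y => (1 / 2 + N) * (1 / 2 - N) / (1 / 2) * ((1 / 2 + N + 1) *
    (1 / 2 - N + 1) / (1 / 2 + 1) *
    ordinaryHypergeometric (1 / 2 + N + 1 + 1) (1 / 2 - N + 1 + 1) (1 / 2 + 1 + 1 : ℝ) y) with hF2
  have dF {y : ℝ} (hy : |y| < 1) : HasDerivAt F (F1 y) y :=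
    hasDerivAt_ordinaryHypergeometric _ _ _ (by norm_num) hy
  have dF1 {y : ℝ} (hy : |y| < 1) : HasDerivAt F1 (F2 y) y :=
    (hasDerivAt_ordinaryHypergeometric _ _ _ (by norm_num) hy).const_mul _
  set σ : ℝ → ℝ := fun t => Real.sin (t / 2) with hσ
  set κ : ℝ → ℝ := fun t => Real.cos (t / 2) with hκ
  have dσ (t : ℝ) : HasDerivAt σ (κ t / 2) t :=
    ((Real.hasDerivAt_sin _).comp t ((hasDerivAt_id t).div_const 2)).congr_deriv (by simp [hκ]; ring)
  have dκ (t : ℝ) : HasDerivAt κ (-σ t / 2) t :=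
    ((Real.hasDerivAt_cos _).comp t ((hasDerivAt_id t).div_const 2)).congr_deriv (by simp [hσ]; ring)
  have hsq (t : ℝ) : σ t ^ 2 + κ t ^ 2 = 1 := Real.sin_sq_add_cos_sq _
  have hlt {t : ℝ} (ht : t ∈ Set.Icc 0 θ) : |σ t ^ 2| < 1 := by
    have hk : 0 < κ t := Real.cos_pos_of_mem_Ioo ⟨by linarith [ht.1, Real.pi_pos], by linarith [ht.2]⟩
    rw [abs_of_nonneg (sq_nonneg _)]
    nlinarith [hsq t]
  have dz (t : ℝ) : HasDerivAt (fun t => σ t ^ 2) (σ t * κ t) t :=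
    ((dσ t).pow 2).congr_deriv (by simp; ring)
  set y : ℝ → ℝ := fun t => κ t * F (σ t ^ 2) with hy
  set y1 : ℝ → ℝ := fun t => -σ t / 2 * F (σ t ^ 2) + κ t * (F1 (σ t ^ 2) * (σ t * κ t)) with hy1
  have dy {t : ℝ} (ht : t ∈ Set.Icc 0 θ) : HasDerivAt y (y1 t) t :=
    (dκ t).mul (HasDerivAt.comp (h₂ := F) t (dF (hlt ht)) (dz t))
  have dy1 {t : ℝ} (ht : t ∈ Set.Icc 0 θ) : HasDerivAt y1 (-(N ^ 2) * y t) t := by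
    have e := (((dσ t).neg.div_const 2).mul (HasDerivAt.comp (h₂ := F) t (dF (hlt ht)) (dz t))).add
      ((dκ t).mul ((HasDerivAt.comp (h₂ := F1) t (dF1 (hlt ht)) (dz t)).mul ((dσ t).mul (dκ t))))
    refine e.congr_deriv ?_
    have o := ordinaryHypergeometric_ode (1 / 2 + N) (1 / 2 - N) (1 / 2) (by norm_num) (hlt ht)
    change σ t ^ 2 * (1 - σ t ^ 2) * F2 (σ t ^ 2)
      + (1 / 2 - (1 / 2 + N + (1 / 2 - N) + 1) * σ t ^ 2) * F1 (σ t ^ 2)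
      - (1 / 2 + N) * (1 / 2 - N) * F (σ t ^ 2) = 0 at o
    have hk : κ t ^ 2 = 1 - σ t ^ 2 := by linarith [hsq t]
    simp only [hy, Function.comp, Pi.mul_apply, Pi.neg_apply]
    linear_combination κ t * o + (κ t * F2 (σ t ^ 2) * σ t ^ 2 + κ t * F1 (σ t ^ 2) / 2) * hk
  -- `A` and `B` are the coordinates of `y` in the basis `cos (N t)`, `sin (N t)`; they are constant.
  set A : ℝ → ℝ := fun t => y t * Real.cos (N * t) - y1 t / N * Real.sin (N * t) with hA
  set B : ℝ → ℝ := fun t => y t * Real.sin (N * t) + y1 t / N * Real.cos (N * t) with hB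
  have dc (t : ℝ) : HasDerivAt (fun t => Real.cos (N * t)) (-(N * Real.sin (N * t))) t :=
    ((Real.hasDerivAt_cos _).comp t ((hasDerivAt_id t).const_mul N)).congr_deriv (by simp; ring)
  have ds (t : ℝ) : HasDerivAt (fun t => Real.sin (N * t)) (N * Real.cos (N * t)) t :=
    ((Real.hasDerivAt_sin _).comp t ((hasDerivAt_id t).const_mul N)).congr_deriv (by simp; ring)
  have dA {t : ℝ} (ht : t ∈ Set.Icc 0 θ) : HasDerivAt A 0 t :=
    (((dy ht).mul (dc t)).sub (((dy1 ht).div_const N).mul (ds t))).congr_deriv (by field_simp; ring)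
  have dB {t : ℝ} (ht : t ∈ Set.Icc 0 θ) : HasDerivAt B 0 t :=
    (((dy ht).mul (ds t)).add (((dy1 ht).div_const N).mul (dc t))).congr_deriv (by field_simp; ring)
  have hconst {f : ℝ → ℝ} (hf : ∀ t ∈ Set.Icc 0 θ, HasDerivAt f 0 t) : f θ = f 0 :=
    constant_of_has_deriv_right_zero (fun t ht => (hf t ht).continuousAt.continuousWithinAt)
      (fun t ht => (hf t ⟨ht.1, ht.2.le⟩).hasDerivWithinAt) θ ⟨h0, le_rfl⟩
  have hA1 : A θ = 1 := by
    rw [hconst fun t ht => dA ht]; simp [hA, hy, hy1, hσ, hκ, hF]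
  have hB1 : B θ = 0 := by
    rw [hconst fun t ht => dB ht]; simp [hB, hy, hy1, hσ, hκ]
  change y θ = _
  have := Real.sin_sq_add_cos_sq (N * θ)
  simp only [hA, hB] at hA1 hB1
  linear_combination Real.cos (N * θ) * hA1 + Real.sin (N * θ) * hB1 - y θ * this

/-! ### The Mehler–Dirichlet integral -/

theorem integral_Ioo_rpow_mul_sub_rpow {p q z : ℝ} (hp : 0 < p) (hq : 0 < q) (hz : 0 < z) :
    ∫ s in Set.Ioo 0 z, s ^ (p - 1) * (z - s) ^ (q - 1) =
      z ^ (p + q - 1) * ProbabilityTheory.beta p q := by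
  have h := Complex.betaIntegral_scaled p q hz
  rw [Complex.betaIntegral_eq_Gamma_mul_div _ _ (by simpa) (by simpa)] at h
  rw [ProbabilityTheory.beta, ← Complex.ofReal_inj]
  push_cast [Complex.ofReal_cpow hz.le, ← Complex.Gamma_ofReal]
  rw [← h, ← integral_complex_ofReal, intervalIntegral.integral_of_le hz.le,
    MeasureTheory.integral_Ioc_eq_integral_Ioo]
  refine MeasureTheory.setIntegral_congr_fun measurableSet_Ioo fun s hs => ?_
  have h1 : 0 ≤ z - s := by linarith [hs.2]
  change ((s ^ (p - 1) * (z - s) ^ (q - 1) : ℝ) : ℂ) = _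
  rw [Complex.ofReal_mul, Complex.ofReal_cpow hs.1.le, Complex.ofReal_cpow h1]
  push_cast
  rfl

theorem integrableOn_Ioo_rpow_mul_sub_rpow {p q z : ℝ} (hp : 0 < p) (hq : 0 < q) (hz : 0 < z) :
    MeasureTheory.IntegrableOn (fun s => s ^ (p - 1) * (z - s) ^ (q - 1)) (Set.Ioo 0 z) := by
  by_contra h
  -- The Bochner integral of a non-integrable function is `0`, but the beta integral is positive.
  have h1 := integral_Ioo_rpow_mul_sub_rpow hp hq hz
  rw [MeasureTheory.integral_undef h] at h1
  exact (mul_pos (Real.rpow_pos_of_pos hz _) (ProbabilityTheory.beta_pos hp hq)).ne h1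

theorem beta_add_nat_mul_ascPochhammer {c q : ℝ} (hc : 0 < c) (hq : 0 < q) (n : ℕ) :
    ProbabilityTheory.beta (c + n) q * (ascPochhammer ℝ n).eval (c + q) =
      ProbabilityTheory.beta c q * (ascPochhammer ℝ n).eval c := by
  induction n with
  | zero => simp
  | succ n ih =>
    have h1 : (0 : ℝ) < c + n := by positivity
    have h2 : (0 : ℝ) < c + n + q := by positivity
    have h3 := Real.Gamma_pos_of_pos h2
    have h4 := Real.Gamma_pos_of_pos h1
    have key : ProbabilityTheory.beta (c + (n + 1 : ℕ)) q * (c + q + n) =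
        ProbabilityTheory.beta (c + n) q * (c + n) := by
      simp only [ProbabilityTheory.beta]
      rw [show c + ((n + 1 : ℕ) : ℝ) = c + n + 1 by push_cast; ring,
        show c + n + 1 + q = c + n + q + 1 by ring, Real.Gamma_add_one h1.ne',
        Real.Gamma_add_one h2.ne']
      field_simp
      ring
    rw [ascPochhammer_succ_eval, ascPochhammer_succ_eval]
    linear_combination (ascPochhammer ℝ n).eval (c + q) * key + (c + n) * ih

/-- Bateman's fractional integral of the hypergeometric function, by termwise integration. -/
theorem integral_rpow_mul_ordinaryHypergeometric (a b : ℝ) {c q z : ℝ} (hc : 0 < c) (hq : 0 < q)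
    (hz : 0 < z) (hz1 : z < 1) :
    ∫ s in Set.Ioo 0 z, s ^ (c - 1) * (z - s) ^ (q - 1) * ordinaryHypergeometric a b c s =
      ProbabilityTheory.beta c q * z ^ (c + q - 1) * ordinaryHypergeometric a b (c + q) z := by
  set u := ordinaryHypergeometricCoefficient a b c with hu
  set B : ℝ → ℝ := fun s => s ^ (c - 1) * (z - s) ^ (q - 1) with hB
  have hB0 {s : ℝ} (hs : s ∈ Set.Ioo 0 z) : 0 ≤ B s :=
    mul_nonneg (Real.rpow_nonneg hs.1.le _) (Real.rpow_nonneg (by linarith [hs.2]) _)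
  set f : ℕ → ℝ → ℝ := fun n s => u n * (s ^ n * B s) with hf
  have hpow (n : ℕ) {s : ℝ} (hs : s ∈ Set.Ioo 0 z) :
      s ^ n * B s = s ^ (c + n - 1) * (z - s) ^ (q - 1) := by
    rw [hB, show c + n - 1 = (n : ℝ) + (c - 1) by ring, Real.rpow_add hs.1, Real.rpow_natCast]
    ring
  have hint (n : ℕ) : MeasureTheory.IntegrableOn (fun s => s ^ n * B s) (Set.Ioo 0 z) :=
    (integrableOn_Ioo_rpow_mul_sub_rpow (p := c + n) (by positivity) hq hz).congr_fun
      (fun s hs => (hpow n hs).symm) measurableSet_Ioo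
  have hfint (n : ℕ) : MeasureTheory.IntegrableOn (f n) (Set.Ioo 0 z) := (hint n).const_mul _
  have hval (n : ℕ) : ∫ s in Set.Ioo 0 z, f n s =
      ProbabilityTheory.beta c q * z ^ (c + q - 1) *
        (ordinaryHypergeometricCoefficient a b (c + q) n * z ^ n) := by
    simp only [hf]
    rw [MeasureTheory.integral_const_mul, MeasureTheory.setIntegral_congr_fun measurableSet_Ioo
      (fun s hs => hpow n hs), integral_Ioo_rpow_mul_sub_rpow (by positivity) hq hz,
      show c + n + q - 1 = (c + q - 1) + n by ring, Real.rpow_add hz, Real.rpow_natCast]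
    have h1 : (ascPochhammer ℝ n).eval c ≠ 0 := (ascPochhammer_pos n c hc).ne'
    have h2 : (ascPochhammer ℝ n).eval (c + q) ≠ 0 :=
      (ascPochhammer_pos n (c + q) (by positivity)).ne'
    have h3 := beta_add_nat_mul_ascPochhammer hc hq n
    have h4 : ProbabilityTheory.beta (c + n) q =
        ProbabilityTheory.beta c q * (ascPochhammer ℝ n).eval c / (ascPochhammer ℝ n).eval (c + q) := by
      rw [← h3]; field_simp
    rw [h4, hu, ordinaryHypergeometricCoefficient, ordinaryHypergeometricCoefficient]
    field_simp
  have hnorm : Summable fun n => ∫ s in Set.Ioo 0 z, ‖f n s‖ := by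
    refine Summable.of_nonneg_of_le (fun n => MeasureTheory.integral_nonneg fun s => norm_nonneg _)
      (fun n => ?_) ((summable_abs_ordinaryHypergeometricCoefficient a b c hc hz.le hz1).mul_right
        (∫ s in Set.Ioo 0 z, B s))
    rw [← MeasureTheory.integral_const_mul]
    refine MeasureTheory.setIntegral_mono_on (hfint n).norm
      ((integrableOn_Ioo_rpow_mul_sub_rpow hc hq hz).const_mul _) measurableSet_Ioo fun s hs => ?_
    simp only [hf, norm_mul, norm_pow, Real.norm_eq_abs, abs_of_nonneg (hB0 hs), abs_of_pos hs.1]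
    rw [mul_assoc]
    have := hB0 hs
    have := hs.1.le
    have := hs.2.le
    gcongr
  have hsum := MeasureTheory.hasSum_integral_of_summable_integral_norm hfint hnorm
  have hz' : |z| < 1 := by rwa [abs_of_pos hz]
  have hsum2 := (hasSum_ordinaryHypergeometric a b (c + q) (by positivity) hz').mul_left
    (ProbabilityTheory.beta c q * z ^ (c + q - 1))
  rw [hsum2.unique (hsum.congr_fun fun n => (hval n).symm)]
  refine MeasureTheory.setIntegral_congr_fun measurableSet_Ioo fun s hs => ?_
  have hs1 : |s| < 1 := by rw [abs_of_pos hs.1]; linarith [hs.2]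
  have h5 := ((hasSum_ordinaryHypergeometric a b c hc hs1).mul_left (B s)).tsum_eq
  change B s * _ = _
  rw [← h5]
  refine tsum_congr fun n => ?_
  simp only [hf]; ring

theorem injOn_sin_half_sq {φ : ℝ} (hφ : φ < Real.pi) :
    Set.InjOn (fun t => Real.sin (t / 2) ^ 2) (Set.Ioo 0 φ) := by
  intro x hx y hy hxy
  have e (t : ℝ) : Real.sin (t / 2) ^ 2 = (1 - Real.cos t) / 2 := by
    rw [Real.sin_sq_eq_half_sub, show 2 * (t / 2) = t by ring]; ring
  simp only [e] at hxy
  exact Real.injOn_cos ⟨hx.1.le, hx.2.le.trans hφ.le⟩ ⟨hy.1.le, hy.2.le.trans hφ.le⟩ (by linarith)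

theorem image_sin_half_sq {φ : ℝ} (h0 : 0 < φ) (hφ : φ < Real.pi) :
    (fun t => Real.sin (t / 2) ^ 2) '' Set.Ioo 0 φ = Set.Ioo 0 (Real.sin (φ / 2) ^ 2) := by
  have e (t : ℝ) : Real.sin (t / 2) ^ 2 = (1 - Real.cos t) / 2 := by
    rw [Real.sin_sq_eq_half_sub, show 2 * (t / 2) = t by ring]; ring
  simp only [e]
  apply Set.Subset.antisymm
  · rintro _ ⟨t, ht, rfl⟩
    have h1 := Real.cos_lt_cos_of_nonneg_of_le_pi le_rfl (by linarith [ht.2] : t ≤ Real.pi) ht.1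
    have h2 := Real.cos_lt_cos_of_nonneg_of_le_pi ht.1.le hφ.le ht.2
    rw [Real.cos_zero] at h1
    constructor <;> linarith
  · have := intermediate_value_Ioo h0.le (f := fun t => (1 - Real.cos t) / 2)
      (by fun_prop : Continuous fun t => (1 - Real.cos t) / 2).continuousOn
    simpa using this

theorem hasDerivAt_sin_half_sq (t : ℝ) :
    HasDerivAt (fun t => Real.sin (t / 2) ^ 2) (Real.sin (t / 2) * Real.cos (t / 2)) t :=
  (((Real.hasDerivAt_sin _).comp t ((hasDerivAt_id t).div_const 2)).pow 2).congr_deriv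
    (by simp; ring)

theorem cos_sub_cos_eq_two_mul_sin_half_sq (θ φ : ℝ) :
    Real.cos θ - Real.cos φ = 2 * (Real.sin (φ / 2) ^ 2 - Real.sin (θ / 2) ^ 2) := by
  rw [Real.sin_sq_eq_half_sub, Real.sin_sq_eq_half_sub, show 2 * (φ / 2) = φ by ring,
    show 2 * (θ / 2) = θ by ring]
  ring

/-- The substitution `s = sin² (θ / 2)` in the weight of the fractional integral. -/
theorem abs_deriv_mul_weight {φ lam θ : ℝ} (hφ : φ < Real.pi) (hθ : θ ∈ Set.Ioo 0 φ) :
    |Real.sin (θ / 2) * Real.cos (θ / 2)| * ((Real.sin (θ / 2) ^ 2) ^ ((1 / 2 : ℝ) - 1) *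
        (Real.sin (φ / 2) ^ 2 - Real.sin (θ / 2) ^ 2) ^ (lam - 1)) =
      2 ^ (1 - lam) * (Real.cos (θ / 2) * (Real.cos θ - Real.cos φ) ^ (lam - 1)) := by
  have hs : 0 < Real.sin (θ / 2) := Real.sin_pos_of_pos_of_lt_pi (by linarith [hθ.1])
    (by linarith [hθ.1, hθ.2])
  have hc : 0 < Real.cos (θ / 2) := Real.cos_pos_of_mem_Ioo
    ⟨by linarith [hθ.1, hθ.2], by linarith [hθ.1, hθ.2]⟩
  have hlt := Real.cos_lt_cos_of_nonneg_of_le_pi hθ.1.le hφ.le hθ.2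
  have hd := cos_sub_cos_eq_two_mul_sin_half_sq θ φ
  have hpos : 0 < Real.sin (φ / 2) ^ 2 - Real.sin (θ / 2) ^ 2 := by linarith
  have h1 : (Real.sin (θ / 2) ^ 2) ^ ((1 / 2 : ℝ) - 1) = (Real.sin (θ / 2))⁻¹ := by
    rw [← Real.rpow_natCast, ← Real.rpow_mul hs.le, ← Real.rpow_neg_one]
    norm_num
  have h2 : (2 : ℝ) ^ (1 - lam) * 2 ^ (lam - 1) = 1 := by
    rw [← Real.rpow_add two_pos]; simp
  rw [abs_of_pos (by positivity), h1, hd, Real.mul_rpow two_pos.le hpos.le]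
  have h3 : Real.sin (θ / 2) * (Real.sin (θ / 2))⁻¹ = 1 := mul_inv_cancel₀ hs.ne'
  linear_combination Real.cos (θ / 2) * (Real.sin (φ / 2) ^ 2 - Real.sin (θ / 2) ^ 2) ^ (lam - 1) *
    (h3 - h2)

/-- The weight is integrable for every `lam > 0`: after the substitution `s = sin² (θ / 2)` it is
comparable to a beta integrand, since `cos (θ / 2)` is bounded below on `(0, φ)`. -/
theorem integrableOn_cos_sub_cos_rpow {lam φ : ℝ} (hlam : 0 < lam) (h0 : 0 < φ)
    (hφ : φ < Real.pi) :
    MeasureTheory.IntegrableOn (fun θ => (Real.cos θ - Real.cos φ) ^ (lam - 1)) (Set.Ioo 0 φ) := by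
  have hzpos : 0 < Real.sin (φ / 2) ^ 2 :=
    pow_pos (Real.sin_pos_of_pos_of_lt_pi (by linarith) (by linarith)) 2
  have h1 := integrableOn_Ioo_rpow_mul_sub_rpow (p := 1 / 2) (by norm_num) hlam hzpos
  rw [← image_sin_half_sq h0 hφ, MeasureTheory.integrableOn_image_iff_integrableOn_abs_deriv_smul
    measurableSet_Ioo (fun t _ => (hasDerivAt_sin_half_sq t).hasDerivWithinAt)
    (injOn_sin_half_sq hφ)] at h1
  have h2 := (h1.congr_fun (fun θ hθ => abs_deriv_mul_weight (lam := lam) hφ hθ)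
    measurableSet_Ioo).const_mul (2 ^ (lam - 1) / Real.cos (φ / 2))
  have hcφ : 0 < Real.cos (φ / 2) := Real.cos_pos_of_mem_Ioo ⟨by linarith, by linarith⟩
  have h3 : (2 : ℝ) ^ (lam - 1) * 2 ^ (1 - lam) = 1 := by
    rw [← Real.rpow_add two_pos]; simp
  refine MeasureTheory.Integrable.mono' h2
    (((Real.measurable_cos.sub_const _).pow_const _).aestronglyMeasurable)
    ((MeasureTheory.ae_restrict_iff' measurableSet_Ioo).2 (Filter.Eventually.of_forall ?_))
  intro θ hθ
  have hlt := Real.cos_lt_cos_of_nonneg_of_le_pi hθ.1.le hφ.le hθ.2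
  have hw : 0 ≤ (Real.cos θ - Real.cos φ) ^ (lam - 1) := Real.rpow_nonneg (by linarith) _
  have hcc : Real.cos (φ / 2) ≤ Real.cos (θ / 2) :=
    Real.cos_le_cos_of_nonneg_of_le_pi (by linarith [hθ.1]) (by linarith) (by linarith [hθ.2])
  rw [Real.norm_of_nonneg hw]
  calc (Real.cos θ - Real.cos φ) ^ (lam - 1)
      ≤ Real.cos (θ / 2) / Real.cos (φ / 2) * (Real.cos θ - Real.cos φ) ^ (lam - 1) :=
        le_mul_of_one_le_left hw ((one_le_div hcφ).2 hcc)
    _ = _ := by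
      field_simp
      linear_combination -Real.cos (θ / 2) * (Real.cos θ - Real.cos φ) ^ (lam - 1) * h3

/-- The Mehler–Dirichlet representation of the right generalised Gegenbauer function. With
`s = sin² (θ / 2)` the integral becomes Bateman's integral of
`₂F₁(1/2 + N, 1/2 - N; 1/2; s)`, where `N = ν + lam`, and Euler's transformation turns the
result into `rightGGF`. -/
theorem integral_cos_mul_cos_sub_cos_rpow {lam ν φ : ℝ} (hlam : 0 < lam) (hν : 0 ≤ ν) (h0 : 0 < φ)
    (hφ : φ < Real.pi) :
    ∫ θ in Set.Ioo 0 φ, Real.cos ((ν + lam) * θ) * (Real.cos θ - Real.cos φ) ^ (lam - 1) =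
      Real.sqrt Real.pi * Real.Gamma lam / (2 ^ lam * Real.Gamma (lam + 1 / 2)) *
        Real.sin φ ^ (2 * lam - 1) * rightGGF lam ν (Real.cos φ) := by
  have hs : 0 < Real.sin (φ / 2) := Real.sin_pos_of_pos_of_lt_pi (by linarith) (by linarith)
  have hc : 0 < Real.cos (φ / 2) := Real.cos_pos_of_mem_Ioo ⟨by linarith, by linarith⟩
  set z := Real.sin (φ / 2) ^ 2 with hz
  have hzc : 1 - z = Real.cos (φ / 2) ^ 2 := by rw [hz]; linarith [Real.sin_sq_add_cos_sq (φ / 2)]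
  have hzpos : 0 < z := pow_pos hs 2
  have hz1 : z < 1 := by have := pow_pos hc 2; linarith
  have hN : 0 < ν + lam := by linarith
  have h1 := integral_rpow_mul_ordinaryHypergeometric (1 / 2 + (ν + lam)) (1 / 2 - (ν + lam))
    (c := 1 / 2) (by norm_num) hlam hzpos hz1
  rw [hz, ← image_sin_half_sq h0 hφ, MeasureTheory.integral_image_eq_integral_abs_deriv_smul
    measurableSet_Ioo (fun t _ => (hasDerivAt_sin_half_sq t).hasDerivWithinAt)
    (injOn_sin_half_sq hφ), ← hz] at h1
  have h2 : ∀ θ ∈ Set.Ioo 0 φ, |Real.sin (θ / 2) * Real.cos (θ / 2)| •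
      ((Real.sin (θ / 2) ^ 2) ^ ((1 / 2 : ℝ) - 1) * (z - Real.sin (θ / 2) ^ 2) ^ (lam - 1) *
        ordinaryHypergeometric (1 / 2 + (ν + lam)) (1 / 2 - (ν + lam)) (1 / 2 : ℝ)
          (Real.sin (θ / 2) ^ 2)) =
      2 ^ (1 - lam) * (Real.cos ((ν + lam) * θ) * (Real.cos θ - Real.cos φ) ^ (lam - 1)) := by
    intro θ hθ
    rw [← cos_half_mul_ordinaryHypergeometric hN hθ.1.le (hθ.2.trans hφ), smul_eq_mul, ← mul_assoc,
      abs_deriv_mul_weight hφ hθ]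
    ring
  rw [MeasureTheory.setIntegral_congr_fun measurableSet_Ioo h2,
    MeasureTheory.integral_const_mul] at h1
  have h3 := ordinaryHypergeometric_euler (1 / 2 + (ν + lam)) (1 / 2 - (ν + lam)) (1 / 2 + lam)
    (by positivity) (z := z) (by rwa [abs_of_pos hzpos])
  have h4 : rightGGF lam ν (Real.cos φ) = ordinaryHypergeometric (1 / 2 + lam - (1 / 2 + (ν + lam)))
      (1 / 2 + lam - (1 / 2 - (ν + lam))) (1 / 2 + lam) z := by
    rw [rightGGF]
    have : (1 - Real.cos φ) / 2 = z := by
      rw [hz, Real.sin_sq_eq_half_sub, show 2 * (φ / 2) = φ by ring]; ring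
    rw [this]
    congr 1 <;> ring
  rw [← h3, ← h4] at h1
  have h5 : (1 - z) ^ (1 / 2 + lam - (1 / 2 + (ν + lam)) - (1 / 2 - (ν + lam))) =
      Real.cos (φ / 2) ^ (2 * lam - 1) := by
    rw [hzc, ← Real.rpow_natCast, ← Real.rpow_mul hc.le]; congr 1; push_cast; ring
  have h6 : z ^ (1 / 2 + lam - 1) = Real.sin (φ / 2) ^ (2 * lam - 1) := by
    rw [hz, ← Real.rpow_natCast, ← Real.rpow_mul hs.le]; congr 1; push_cast; ring
  have h7 : Real.sin φ ^ (2 * lam - 1) =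
      2 ^ (2 * lam - 1) * (Real.sin (φ / 2) ^ (2 * lam - 1) * Real.cos (φ / 2) ^ (2 * lam - 1)) := by
    rw [← Real.mul_rpow hs.le hc.le, ← Real.mul_rpow two_pos.le (by positivity), ← mul_assoc,
      ← Real.sin_two_mul, show 2 * (φ / 2) = φ by ring]
  rw [h5, h6, ProbabilityTheory.beta, Real.Gamma_one_half_eq, add_comm (1 / 2) lam] at h1
  have h8 : (2 : ℝ) ^ (2 * lam - 1) = 2 ^ lam * (2 ^ (1 - lam))⁻¹ := by
    rw [← Real.rpow_neg two_pos.le, ← Real.rpow_add two_pos]; congr 1; ring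
  have hG : Real.Gamma (lam + 1 / 2) ≠ 0 := (Real.Gamma_pos_of_pos (by positivity)).ne'
  have h2p : (2 : ℝ) ^ (1 - lam) ≠ 0 := (Real.rpow_pos_of_pos two_pos _).ne'
  rw [h7, h8]
  field_simp
  field_simp at h1
  linear_combination h1

/-! ### Deformation of the contour -/

theorem cos_sub_I_mul_re (x t : ℝ) :
    (Complex.cos ((x : ℂ) - Complex.I * (t : ℂ))).re = Real.cos x * Real.cosh t := by
  rw [Complex.cos_sub, mul_comm Complex.I, Complex.cos_mul_I, Complex.sin_mul_I]
  simp [← Complex.ofReal_cos, ← Complex.ofReal_sin, ← Complex.ofReal_cosh, ← Complex.ofReal_sinh]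

theorem cos_sub_I_mul_im (x t : ℝ) :
    (Complex.cos ((x : ℂ) - Complex.I * (t : ℂ))).im = Real.sin x * Real.sinh t := by
  rw [Complex.cos_sub, mul_comm Complex.I, Complex.cos_mul_I, Complex.sin_mul_I]
  simp [← Complex.ofReal_cos, ← Complex.ofReal_sin, ← Complex.ofReal_cosh, ← Complex.ofReal_sinh]

theorem norm_cos_sub_I_mul_sq (x t : ℝ) :
    ‖Complex.cos ((x : ℂ) - Complex.I * (t : ℂ))‖ ^ 2 = Real.cos x ^ 2 + Real.sinh t ^ 2 := by
  rw [Complex.sq_norm, Complex.normSq_apply, cos_sub_I_mul_re, cos_sub_I_mul_im]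
  linear_combination Real.cos x ^ 2 * Real.cosh_sq t + Real.sinh t ^ 2 * Real.sin_sq_add_cos_sq x

theorem cosh_le_exp {t : ℝ} (ht : 0 ≤ t) : Real.cosh t ≤ Real.exp t := by
  rw [Real.cosh_eq]
  have : Real.exp (-t) ≤ Real.exp t := Real.exp_le_exp.2 (by linarith)
  linarith

theorem norm_cos_sub_cos_le (x φ : ℝ) {t : ℝ} (ht : 0 ≤ t) :
    ‖Complex.cos ((x : ℂ) - Complex.I * (t : ℂ)) - Complex.cos (φ : ℂ)‖ ≤ 2 * Real.exp t := by
  have h1 : ‖Complex.cos ((x : ℂ) - Complex.I * (t : ℂ))‖ ≤ Real.cosh t := by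
    refine abs_le_of_sq_le_sq' ?_ (Real.cosh_pos t).le |>.2
    rw [norm_cos_sub_I_mul_sq, Real.cosh_sq]
    linarith [Real.cos_sq_le_one x]
  have h2 : ‖Complex.cos (φ : ℂ)‖ ≤ 1 := by
    rw [← Complex.ofReal_cos, Complex.norm_real]; exact Real.abs_cos_le_one φ
  have h3 := norm_sub_le (Complex.cos ((x : ℂ) - Complex.I * (t : ℂ))) (Complex.cos (φ : ℂ))
  have h4 := Real.one_le_exp ht
  have h5 := cosh_le_exp ht
  linarith

theorem sinh_sub_one_le_norm_cos_sub_cos (x φ t : ℝ) :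
    Real.sinh t - 1 ≤ ‖Complex.cos ((x : ℂ) - Complex.I * (t : ℂ)) - Complex.cos (φ : ℂ)‖ := by
  have h1 : Real.sinh t ≤ ‖Complex.cos ((x : ℂ) - Complex.I * (t : ℂ))‖ := by
    refine abs_le_of_sq_le_sq' ?_ (norm_nonneg _) |>.2
    rw [norm_cos_sub_I_mul_sq]
    nlinarith [sq_nonneg (Real.cos x)]
  have h2 : ‖Complex.cos (φ : ℂ)‖ ≤ 1 := by
    rw [← Complex.ofReal_cos, Complex.norm_real]; exact Real.abs_cos_le_one φ
  have h3 := norm_sub_norm_le (Complex.cos ((x : ℂ) - Complex.I * (t : ℂ))) (Complex.cos (φ : ℂ))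
  linarith

theorem mul_le_norm_cos_sub_cos {x φ t c : ℝ} (hc : 0 ≤ c) (hcx : c ≤ Real.sin x) (ht : 0 ≤ t) :
    c * t ≤ ‖Complex.cos ((x : ℂ) - Complex.I * (t : ℂ)) - Complex.cos (φ : ℂ)‖ := by
  have him : (Complex.cos ((x : ℂ) - Complex.I * (t : ℂ)) - Complex.cos (φ : ℂ)).im =
      Real.sin x * Real.sinh t := by
    rw [Complex.sub_im, cos_sub_I_mul_im, ← Complex.ofReal_cos, Complex.ofReal_im, sub_zero]
  calc c * t ≤ Real.sin x * Real.sinh t :=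
        mul_le_mul hcx (Real.self_le_sinh_iff.2 ht) ht (hc.trans hcx)
    _ ≤ _ := by rw [← him]; exact (le_abs_self _).trans (Complex.abs_im_le_norm _)

/-- On the half-strip `0 ≤ re θ ≤ φ`, `im θ ≤ 0`, with the corner `φ` removed, the principal
power of `cos θ - cos φ` stays off the branch cut: the base lies in the open upper half-plane, or
it is positive when `θ` is on the imaginary axis or on the real axis. -/
theorem cos_sub_cos_mem_slitPlane {x φ t : ℝ} (hφ : φ < Real.pi) (hx0 : 0 ≤ x) (hxφ : x ≤ φ)
    (ht : 0 ≤ t) (h : x < φ ∨ (0 < x ∧ 0 < t)) :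
    Complex.cos ((x : ℂ) - Complex.I * (t : ℂ)) - Complex.cos (φ : ℂ) ∈ Complex.slitPlane := by
  rw [Complex.mem_slitPlane_iff, Complex.sub_im, Complex.sub_re, cos_sub_I_mul_re, cos_sub_I_mul_im,
    ← Complex.ofReal_cos, Complex.ofReal_im, Complex.ofReal_re, sub_zero]
  by_cases hpos : 0 < x ∧ 0 < t
  · right
    have h1 := Real.sin_pos_of_pos_of_lt_pi hpos.1 (hxφ.trans_lt hφ)
    have h2 := Real.sinh_pos_iff.2 hpos.2
    positivity
  · left
    have hlt := h.resolve_right hpos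
    have h1 := Real.cos_lt_cos_of_nonneg_of_le_pi hx0 hφ.le hlt
    rcases hx0.eq_or_lt with rfl | hx
    · have := Real.one_le_cosh t
      rw [Real.cos_zero] at h1 ⊢
      linarith
    · obtain rfl : t = 0 := le_antisymm (not_lt.1 fun h' => hpos ⟨hx, h'⟩) ht
      simpa using h1

/-- The integrand `e^{-i N θ} (cos θ - cos φ)^(lam - 1)` of the Mehler–Dirichlet integral, at a
complex angle `θ`. -/
noncomputable def mehlerKernel (lam N φ : ℝ) (θ : ℂ) : ℂ :=
  Complex.exp (-(Complex.I * N * θ)) * (Complex.cos θ - Complex.cos (φ : ℂ)) ^ ((lam : ℂ) - 1)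

theorem norm_mehlerKernel (lam N φ x t : ℝ) :
    ‖mehlerKernel lam N φ ((x : ℂ) - Complex.I * (t : ℂ))‖ = Real.exp (-(N * t)) *
      ‖Complex.cos ((x : ℂ) - Complex.I * (t : ℂ)) - Complex.cos (φ : ℂ)‖ ^ (lam - 1) := by
  have : ((lam : ℂ) - 1) = ((lam - 1 : ℝ) : ℂ) := by push_cast; rfl
  rw [mehlerKernel, norm_mul, this, Complex.norm_cpow_real, Complex.norm_exp]
  congr 2
  simp

theorem differentiableAt_mehlerKernel {lam N φ x t : ℝ} (hφ : φ < Real.pi) (hx0 : 0 ≤ x)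
    (hxφ : x ≤ φ) (ht : 0 ≤ t) (h : x < φ ∨ (0 < x ∧ 0 < t)) :
    DifferentiableAt ℂ (mehlerKernel lam N φ) ((x : ℂ) - Complex.I * (t : ℂ)) := by
  have h1 : DifferentiableAt ℂ (fun θ : ℂ => Complex.cos θ - Complex.cos (φ : ℂ))
      ((x : ℂ) - Complex.I * (t : ℂ)) := Complex.differentiableAt_cos.sub_const _
  have h2 := h1.cpow (differentiableAt_const ((lam : ℂ) - 1))
    (cos_sub_cos_mem_slitPlane hφ hx0 hxφ ht h)
  have h3 : DifferentiableAt ℂ (fun θ : ℂ => Complex.exp (-(Complex.I * N * θ)))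
      ((x : ℂ) - Complex.I * (t : ℂ)) := by fun_prop
  exact h3.mul h2

/-- On the imaginary axis the kernel is real. -/
theorem mehlerKernel_neg_I_mul (lam N φ t : ℝ) :
    mehlerKernel lam N φ (((0 : ℝ) : ℂ) - Complex.I * (t : ℂ)) =
      ((Real.exp (-(N * t)) * (Real.cosh t - Real.cos φ) ^ (lam - 1) : ℝ) : ℂ) := by
  have h1 : Complex.cos (((0 : ℝ) : ℂ) - Complex.I * (t : ℂ)) = ((Real.cosh t : ℝ) : ℂ) := by
    apply Complex.ext
    · rw [cos_sub_I_mul_re]; simp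
    · rw [cos_sub_I_mul_im]; simp
  have h2 : 0 ≤ Real.cosh t - Real.cos φ := by linarith [Real.one_le_cosh t, Real.cos_le_one φ]
  rw [mehlerKernel, h1, Complex.ofReal_mul, Complex.ofReal_cpow h2]
  have h3 : Complex.I * N * (((0 : ℝ) : ℂ) - Complex.I * (t : ℂ)) = ((N * t : ℝ) : ℂ) := by
    push_cast
    linear_combination -(N : ℂ) * t * Complex.I_mul_I
  rw [h3]
  push_cast
  rfl

theorem rpow_le_add_of_le_of_le {a b x s : ℝ} (ha : 0 < a) (hax : a ≤ x) (hxb : x ≤ b) :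
    x ^ s ≤ a ^ s + b ^ s := by
  have hx : 0 < x := ha.trans_le hax
  rcases le_total 0 s with hs | hs
  · have := Real.rpow_le_rpow hx.le hxb hs
    have := Real.rpow_nonneg ha.le s
    linarith
  · have := Real.rpow_le_rpow_of_nonpos ha hax hs
    have := Real.rpow_nonneg (hx.le.trans hxb) s
    linarith

/-- A majorant of the kernel on vertical lines `re θ = x` with `sin x ≥ c`. It combines
`c t ≤ |cos θ - cos φ| ≤ 2 e ^ t`; the sum of the two powers serves both signs of `lam - 1`. -/
noncomputable def mehlerMajorant (lam N c t : ℝ) : ℝ :=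
  Real.exp (-(N * t)) * ((c * t) ^ (lam - 1) + (2 * Real.exp t) ^ (lam - 1))

theorem norm_mehlerKernel_le {lam N φ x t c : ℝ} (hc : 0 < c) (hcx : c ≤ Real.sin x) (ht : 0 < t) :
    ‖mehlerKernel lam N φ ((x : ℂ) - Complex.I * (t : ℂ))‖ ≤ mehlerMajorant lam N c t := by
  rw [norm_mehlerKernel, mehlerMajorant]
  gcongr
  exact rpow_le_add_of_le_of_le (by positivity) (mul_le_norm_cos_sub_cos hc.le hcx ht.le)
    (norm_cos_sub_cos_le x φ ht.le)

theorem integrableOn_rpow_sub_one_mul_exp {lam N : ℝ} (hlam : 0 < lam) (hN : 0 < N) :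
    MeasureTheory.IntegrableOn (fun t => t ^ (lam - 1) * Real.exp (-(N * t))) (Set.Ioi 0) := by
  have := integrableOn_rpow_mul_exp_neg_mul_rpow (p := 1) (s := lam - 1) (by linarith) one_pos hN
  simpa using this

theorem integrableOn_mehlerMajorant {lam N c : ℝ} (hlam : 0 < lam) (hN : lam ≤ N) (hc : 0 < c) :
    MeasureTheory.IntegrableOn (mehlerMajorant lam N c) (Set.Ioi 0) := by
  have h1 := (integrableOn_rpow_sub_one_mul_exp hlam (hlam.trans_le hN)).const_mul (c ^ (lam - 1))
  have h2 := (exp_neg_integrableOn_Ioi 0 (b := N - lam + 1) (by linarith)).const_mul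
    ((2 : ℝ) ^ (lam - 1))
  refine MeasureTheory.IntegrableOn.congr_fun (h1.add h2) (fun t ht => ?_) measurableSet_Ioi
  have ht' : (0 : ℝ) < t := ht
  simp only [Pi.add_apply, mehlerMajorant]
  rw [Real.mul_rpow hc.le ht'.le, Real.mul_rpow two_pos.le (Real.exp_pos t).le, ← Real.exp_mul,
    show -(N - lam + 1) * t = -(N * t) + t * (lam - 1) by ring, Real.exp_add]
  ring

theorem continuousOn_mehlerKernel_vertical {lam N φ x : ℝ} (hφ : φ < Real.pi) (hx0 : 0 < x)
    (hxφ : x ≤ φ) :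
    ContinuousOn (fun t : ℝ => mehlerKernel lam N φ ((x : ℂ) - Complex.I * (t : ℂ))) (Set.Ioi 0) :=
  fun t ht => (ContinuousAt.comp (g := mehlerKernel lam N φ)
    (f := fun t : ℝ => (x : ℂ) - Complex.I * (t : ℂ))
    (differentiableAt_mehlerKernel hφ hx0.le hxφ (le_of_lt ht)
      (Or.inr ⟨hx0, ht⟩)).continuousAt (by fun_prop)).continuousWithinAt

theorem integrableOn_mehlerKernel_vertical {lam N φ x : ℝ} (hlam : 0 < lam) (hN : lam ≤ N)
    (hφ : φ < Real.pi) (hx0 : 0 < x) (hxφ : x ≤ φ) :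
    MeasureTheory.IntegrableOn
      (fun t : ℝ => mehlerKernel lam N φ ((x : ℂ) - Complex.I * (t : ℂ))) (Set.Ioi 0) := by
  have hs := Real.sin_pos_of_pos_of_lt_pi hx0 (hxφ.trans_lt hφ)
  refine MeasureTheory.Integrable.mono' (integrableOn_mehlerMajorant hlam hN hs)
    ((continuousOn_mehlerKernel_vertical hφ hx0 hxφ).aestronglyMeasurable measurableSet_Ioi)
    ((MeasureTheory.ae_restrict_iff' measurableSet_Ioi).2 (Filter.Eventually.of_forall ?_))
  exact fun t ht => norm_mehlerKernel_le hs le_rfl ht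

/-- The contribution of the far horizontal side of the rectangle vanishes. -/
theorem tendsto_integral_mehlerKernel_horizontal {lam N φ ψ : ℝ} (hlam : 0 < lam) (hN : lam ≤ N) :
    Filter.Tendsto (fun T : ℝ => ∫ x in (0 : ℝ)..ψ,
      mehlerKernel lam N φ ((x : ℂ) - Complex.I * (T : ℂ))) Filter.atTop (nhds 0) := by
  have hlim : Filter.Tendsto (fun T : ℝ => (Real.exp (-(N * T)) +
      2 ^ (lam - 1) * Real.exp (-((N - lam + 1) * T))) * |ψ - 0|) Filter.atTop (nhds 0) := by
    have e (b : ℝ) (hb : 0 < b) :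
        Filter.Tendsto (fun T : ℝ => Real.exp (-(b * T))) Filter.atTop (nhds 0) :=
      Real.tendsto_exp_neg_atTop_nhds_zero.comp (Filter.tendsto_id.const_mul_atTop hb)
    have := ((e N (hlam.trans_le hN)).add
      ((e (N - lam + 1) (by linarith)).const_mul (2 ^ (lam - 1)))).mul_const |ψ - 0|
    simpa using this
  refine squeeze_zero_norm' ?_ hlim
  filter_upwards [Filter.eventually_ge_atTop 2] with T hT
  refine intervalIntegral.norm_integral_le_of_norm_le_const fun x _ => ?_
  have h1 : 1 ≤ ‖Complex.cos ((x : ℂ) - Complex.I * (T : ℂ)) - Complex.cos (φ : ℂ)‖ := by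
    have := sinh_sub_one_le_norm_cos_sub_cos x φ T
    have : T ≤ Real.sinh T := Real.self_le_sinh_iff.2 (by linarith)
    linarith
  have h2 := rpow_le_add_of_le_of_le (s := lam - 1) one_pos h1
    (norm_cos_sub_cos_le x φ (by linarith : 0 ≤ T))
  rw [norm_mehlerKernel]
  refine (mul_le_mul_of_nonneg_left h2 (Real.exp_pos _).le).trans_eq ?_
  rw [Real.one_rpow, Real.mul_rpow two_pos.le (Real.exp_pos T).le, ← Real.exp_mul,
    show -((N - lam + 1) * T) = -(N * T) + T * (lam - 1) by ring, Real.exp_add]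
  ring

/-- Cauchy's theorem on the rectangle `[0, ψ] × [-T, 0]`; the side on the imaginary axis
contributes nothing to the real part. -/
theorem re_integral_mehlerKernel_rect {lam N φ ψ T : ℝ} (hφ : φ < Real.pi) (hψ0 : 0 ≤ ψ)
    (hψ : ψ < φ) (hT : 0 ≤ T) :
    (∫ x in (0 : ℝ)..ψ, mehlerKernel lam N φ (x : ℂ)).re =
      (∫ x in (0 : ℝ)..ψ, mehlerKernel lam N φ ((x : ℂ) - Complex.I * (T : ℂ))).re +
      (Complex.I * ∫ t in (0 : ℝ)..T, mehlerKernel lam N φ ((ψ : ℂ) - Complex.I * (t : ℂ))).re := by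
  have hd : DifferentiableOn ℂ (mehlerKernel lam N φ) (Set.uIcc 0 ψ ×ℂ Set.uIcc (-T) 0) := by
    intro θ hθ
    obtain ⟨h1, h2⟩ := Complex.mem_reProdIm.1 hθ
    rw [Set.uIcc_of_le hψ0] at h1
    rw [Set.uIcc_of_le (by linarith)] at h2
    have e : θ = ((θ.re : ℝ) : ℂ) - Complex.I * ((-θ.im : ℝ) : ℂ) := by
      apply Complex.ext <;> simp
    rw [e]
    exact (differentiableAt_mehlerKernel hφ h1.1 (by linarith [h1.2]) (by linarith [h2.2])
      (Or.inl (by linarith [h1.2]))).differentiableWithinAt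
  have h := Complex.integral_boundary_rect_eq_zero_of_differentiableOn (mehlerKernel lam N φ)
    (⟨0, -T⟩ : ℂ) (⟨ψ, 0⟩ : ℂ) hd
  simp only [smul_eq_mul] at h
  have e1 (x : ℝ) : (∫ y in (-T)..0, mehlerKernel lam N φ ((x : ℂ) + (y : ℂ) * Complex.I)) =
      ∫ t in (0 : ℝ)..T, mehlerKernel lam N φ ((x : ℂ) - Complex.I * (t : ℂ)) := by
    have := intervalIntegral.integral_comp_neg (a := 0) (b := T)
      (fun y : ℝ => mehlerKernel lam N φ ((x : ℂ) + (y : ℂ) * Complex.I))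
    rw [neg_zero] at this
    rw [← this]
    refine intervalIntegral.integral_congr fun t _ => ?_
    congr 1
    push_cast
    ring
  have e2 : (fun x : ℝ => mehlerKernel lam N φ ((x : ℂ) + ((-T : ℝ) : ℂ) * Complex.I)) =
      fun x : ℝ => mehlerKernel lam N φ ((x : ℂ) - Complex.I * (T : ℂ)) := by
    ext x; congr 1; push_cast; ring
  have e3 : (∫ t in (0 : ℝ)..T, mehlerKernel lam N φ (((0 : ℝ) : ℂ) - Complex.I * (t : ℂ))) =
      ((∫ t in (0 : ℝ)..T,
        Real.exp (-(N * t)) * (Real.cosh t - Real.cos φ) ^ (lam - 1) : ℝ) : ℂ) := by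
    rw [← intervalIntegral.integral_ofReal]
    exact intervalIntegral.integral_congr fun t _ => mehlerKernel_neg_I_mul lam N φ t
  rw [e1, e1, e2, e3] at h
  simp only [Complex.ofReal_zero, zero_mul, add_zero] at h
  have hre := congrArg Complex.re h
  rw [Complex.sub_re, Complex.add_re, Complex.sub_re, Complex.re_mul_ofReal, Complex.I_re, zero_mul,
    Complex.zero_re] at hre
  linarith

theorem re_integral_mehlerKernel_of_lt {lam N φ ψ : ℝ} (hlam : 0 < lam) (hN : lam ≤ N)
    (hφ : φ < Real.pi) (hψ0 : 0 < ψ) (hψ : ψ < φ) :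
    (∫ x in (0 : ℝ)..ψ, mehlerKernel lam N φ (x : ℂ)).re =
      (Complex.I * ∫ t in Set.Ioi (0 : ℝ),
        mehlerKernel lam N φ ((ψ : ℂ) - Complex.I * (t : ℂ))).re := by
  have h1 := MeasureTheory.intervalIntegral_tendsto_integral_Ioi 0
    (integrableOn_mehlerKernel_vertical (N := N) hlam hN hφ hψ0 hψ.le) Filter.tendsto_id
  have h2 := ((Complex.continuous_re.tendsto _).comp
    (tendsto_integral_mehlerKernel_horizontal (φ := φ) (ψ := ψ) hlam hN)).add
    ((Complex.continuous_re.tendsto _).comp (h1.const_mul Complex.I))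
  rw [Complex.zero_re, zero_add] at h2
  refine tendsto_nhds_unique (tendsto_const_nhds.congr' ?_) h2
  filter_upwards [Filter.eventually_ge_atTop 0] with T hT
  exact re_integral_mehlerKernel_rect hφ hψ0.le hψ hT

theorem mehlerKernel_ofReal {lam N φ x : ℝ} (h : Real.cos φ ≤ Real.cos x) :
    mehlerKernel lam N φ (x : ℂ) = Complex.exp (((-(N * x) : ℝ) : ℂ) * Complex.I) *
      (((Real.cos x - Real.cos φ) ^ (lam - 1) : ℝ) : ℂ) := by
  rw [mehlerKernel, Complex.ofReal_cpow (by linarith)]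
  push_cast
  congr 2
  ring

theorem integrableOn_mehlerKernel_ofReal {lam N φ : ℝ} (hlam : 0 < lam) (h0 : 0 < φ)
    (hφ : φ < Real.pi) :
    MeasureTheory.IntegrableOn (fun x : ℝ => mehlerKernel lam N φ (x : ℂ)) (Set.Icc 0 φ) := by
  rw [integrableOn_Icc_iff_integrableOn_Ioo]
  have h1 := (integrableOn_cos_sub_cos_rpow hlam h0 hφ).ofReal (𝕜 := ℂ)
  refine MeasureTheory.IntegrableOn.congr_fun (MeasureTheory.Integrable.bdd_mul (c := 1) h1
    (f := fun x : ℝ => Complex.exp (((-(N * x) : ℝ) : ℂ) * Complex.I))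
    (by fun_prop : Continuous fun x : ℝ =>
      Complex.exp (((-(N * x) : ℝ) : ℂ) * Complex.I)).aestronglyMeasurable
    (Filter.Eventually.of_forall fun x => (Complex.norm_exp_ofReal_mul_I _).le))
    (fun x hx => ?_) measurableSet_Ioo
  exact (mehlerKernel_ofReal (Real.cos_le_cos_of_nonneg_of_le_pi hx.1.le hφ.le hx.2.le)).symm

/-- The Mehler–Dirichlet integral as an integral over the vertical half-line below `φ`. The rectangle
argument applies to `ψ < φ` only, because for `lam < 1` the kernel is singular at the corner `φ`;
dominated convergence then gives the limit `ψ → φ`. -/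
theorem re_integral_mehlerKernel {lam N φ : ℝ} (hlam : 0 < lam) (hN : lam ≤ N)
    (h0 : 0 < φ) (hφ : φ < Real.pi) :
    (∫ x in (0 : ℝ)..φ, mehlerKernel lam N φ (x : ℂ)).re =
      (Complex.I * ∫ t in Set.Ioi (0 : ℝ),
        mehlerKernel lam N φ ((φ : ℂ) - Complex.I * (t : ℂ))).re := by
  have hL : Filter.Tendsto (fun ψ : ℝ => ∫ x in (0 : ℝ)..ψ, mehlerKernel lam N φ (x : ℂ))
      (nhdsWithin φ (Set.Ioo (φ / 2) φ)) (nhds (∫ x in (0 : ℝ)..φ, mehlerKernel lam N φ (x : ℂ))) := by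
    have h1 := intervalIntegral.continuousOn_primitive_interval (a := 0) (b := φ)
      (f := fun x : ℝ => mehlerKernel lam N φ (x : ℂ)) (μ := MeasureTheory.volume)
      (by rw [Set.uIcc_of_le h0.le]; exact integrableOn_mehlerKernel_ofReal hlam h0 hφ)
    rw [Set.uIcc_of_le h0.le] at h1
    exact (h1 φ ⟨h0.le, le_rfl⟩).mono fun x hx => ⟨by linarith [hx.1], hx.2.le⟩
  have hhalf : 0 < φ / 2 := by linarith
  set c := min (Real.sin (φ / 2)) (Real.sin φ) with hc
  have hc0 : 0 < c := lt_min (Real.sin_pos_of_pos_of_lt_pi hhalf (by linarith))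
    (Real.sin_pos_of_pos_of_lt_pi h0 hφ)
  have hcle {ψ : ℝ} (hψ : ψ ∈ Set.Ioo (φ / 2) φ) : c ≤ Real.sin ψ :=
    strictConcaveOn_sin_Icc.concaveOn.min_le_of_mem_Icc ⟨by linarith, by linarith⟩
      ⟨h0.le, hφ.le⟩ ⟨hψ.1.le, hψ.2.le⟩
  have hR : Filter.Tendsto (fun ψ : ℝ => ∫ t in Set.Ioi (0 : ℝ),
      mehlerKernel lam N φ ((ψ : ℂ) - Complex.I * (t : ℂ))) (nhdsWithin φ (Set.Ioo (φ / 2) φ))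
      (nhds (∫ t in Set.Ioi (0 : ℝ), mehlerKernel lam N φ ((φ : ℂ) - Complex.I * (t : ℂ)))) := by
    refine MeasureTheory.tendsto_integral_filter_of_dominated_convergence (mehlerMajorant lam N c)
      ?_ ?_ (integrableOn_mehlerMajorant hlam hN hc0) ?_
    · filter_upwards [self_mem_nhdsWithin] with ψ hψ
      exact (continuousOn_mehlerKernel_vertical hφ (hhalf.trans hψ.1) hψ.2.le).aestronglyMeasurable
        measurableSet_Ioi
    · filter_upwards [self_mem_nhdsWithin] with ψ hψ
      exact (MeasureTheory.ae_restrict_iff' measurableSet_Ioi).2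
        (Filter.Eventually.of_forall fun t ht => norm_mehlerKernel_le hc0 (hcle hψ) ht)
    · refine (MeasureTheory.ae_restrict_iff' measurableSet_Ioi).2
        (Filter.Eventually.of_forall fun t ht => ?_)
      exact Filter.Tendsto.mono_left (ContinuousAt.tendsto (ContinuousAt.comp
        (g := mehlerKernel lam N φ) (f := fun x : ℝ => (x : ℂ) - Complex.I * (t : ℂ))
        (differentiableAt_mehlerKernel hφ h0.le le_rfl (le_of_lt ht)
          (Or.inr ⟨h0, ht⟩)).continuousAt (by fun_prop))) nhdsWithin_le_nhds
  have hne : (nhdsWithin φ (Set.Ioo (φ / 2) φ)).NeBot := right_nhdsWithin_Ioo_neBot (by linarith)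
  refine tendsto_nhds_unique ((Complex.continuous_re.tendsto _).comp hL)
    (((Complex.continuous_re.tendsto _).comp (hR.const_mul Complex.I)).congr' ?_)
  filter_upwards [self_mem_nhdsWithin] with ψ hψ
  exact (re_integral_mehlerKernel_of_lt hlam hN hφ (hhalf.trans hψ.1) hψ.2).symm

/-! ### The residual integral -/

theorem ofReal_mul_cpow {r : ℝ} (hr : 0 < r) {w : ℂ} (hw : w ≠ 0) (s : ℂ) :
    ((r : ℂ) * w) ^ s = (r : ℂ) ^ s * w ^ s := by
  have hr' : (r : ℂ) ≠ 0 := Complex.ofReal_ne_zero.2 hr.ne'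
  rw [Complex.cpow_def_of_ne_zero (mul_ne_zero hr' hw), Complex.cpow_def_of_ne_zero hr',
    Complex.cpow_def_of_ne_zero hw, Complex.log_ofReal_mul hr hw, ← Complex.exp_add,
    Complex.ofReal_log hr.le, add_mul]

theorem ofReal_cpow_sub_one {r : ℝ} (hr : 0 < r) (lam : ℝ) :
    (r : ℂ) ^ ((lam : ℂ) - 1) = ((r ^ (lam - 1) : ℝ) : ℂ) := by
  rw [Complex.ofReal_cpow hr.le]; push_cast; rfl

theorem ofReal_mul_ggfG (φ : ℝ) {t : ℝ} (ht : t ≠ 0) :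
    (t : ℂ) * ggfG φ t =
      Complex.cos ((φ : ℂ) - Complex.I * (t : ℂ)) - Complex.cos (φ : ℂ) := by
  have ht' : (t : ℂ) ≠ 0 := Complex.ofReal_ne_zero.2 ht
  rw [ggfG, if_neg ht]
  field_simp

theorem ggfG_ne_zero {φ t : ℝ} (h0 : 0 < φ) (hφ : φ < Real.pi) (ht : 0 < t) : ggfG φ t ≠ 0 := by
  intro h
  have h1 := cos_sub_cos_mem_slitPlane hφ h0.le le_rfl ht.le (Or.inr ⟨h0, ht⟩)
  rw [← ofReal_mul_ggfG φ ht.ne', h, mul_zero] at h1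
  exact Complex.zero_notMem_slitPlane h1

theorem mehlerKernel_eq_ggfG {lam N φ t : ℝ} (h0 : 0 < φ) (hφ : φ < Real.pi) (ht : 0 < t) :
    mehlerKernel lam N φ ((φ : ℂ) - Complex.I * (t : ℂ)) =
      Complex.exp (-(Complex.I * N * φ)) * ggfG φ t ^ ((lam : ℂ) - 1) *
        ((t ^ (lam - 1) * Real.exp (-(N * t)) : ℝ) : ℂ) := by
  have e : -(Complex.I * N * ((φ : ℂ) - Complex.I * (t : ℂ))) =
      -(Complex.I * N * φ) + ((-(N * t) : ℝ) : ℂ) := by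
    push_cast
    linear_combination (N : ℂ) * t * Complex.I_mul_I
  rw [mehlerKernel, ← ofReal_mul_ggfG φ ht.ne', ofReal_mul_cpow ht (ggfG_ne_zero h0 hφ ht),
    ofReal_cpow_sub_one ht, e, Complex.exp_add, ← Complex.ofReal_exp]
  push_cast
  ring

/-- The coefficient of the leading term, which produces the cosine of the asymptotic formula. -/
theorem re_I_mul_exp_mul_ggfG_zero_cpow {lam N φ : ℝ} (h0 : 0 < φ) (hφ : φ < Real.pi) :
    (Complex.I * Complex.exp (-(Complex.I * N * φ)) * ggfG φ 0 ^ ((lam : ℂ) - 1)).re =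
      Real.sin φ ^ (lam - 1) * Real.cos (N * φ - lam * Real.pi / 2) := by
  have hs := Real.sin_pos_of_pos_of_lt_pi h0 hφ
  have hI : Complex.I = Complex.exp (Real.pi / 2 * Complex.I) := by
    rw [Complex.exp_pi_div_two_mul_I]
  have e : Complex.I * Complex.exp (-(Complex.I * N * φ)) * Complex.I ^ ((lam : ℂ) - 1) =
      Complex.exp (((lam * Real.pi / 2 - N * φ : ℝ) : ℂ) * Complex.I) := by
    rw [Complex.cpow_def_of_ne_zero Complex.I_ne_zero, Complex.log_I]
    nth_rewrite 1 [hI]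
    rw [← Complex.exp_add, ← Complex.exp_add]
    congr 1
    push_cast
    ring
  have hg : ggfG φ 0 = (Real.sin φ : ℂ) * Complex.I := by simp [ggfG, mul_comm]
  rw [hg, ofReal_mul_cpow hs Complex.I_ne_zero, ofReal_cpow_sub_one hs, mul_left_comm, e,
    Complex.re_ofReal_mul, Complex.exp_ofReal_mul_I_re, ← Real.cos_neg (lam * Real.pi / 2 - N * φ)]
  congr 2
  ring

/-- The residual integrand is the kernel on the half-line minus its leading term at `t = 0`. -/
theorem ggfResidualIntegrand_eq {lam ν φ t : ℝ} (h0 : 0 < φ) (hφ : φ < Real.pi) (ht : 0 < t) :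
    ggfResidualIntegrand lam ν φ t =
      (Complex.I * mehlerKernel lam (ν + lam) φ ((φ : ℂ) - Complex.I * (t : ℂ))).re -
        Real.sin φ ^ (lam - 1) * Real.cos ((ν + lam) * φ - lam * Real.pi / 2) *
          (t ^ (lam - 1) * Real.exp (-((ν + lam) * t))) := by
  have ht' : (t : ℂ) ≠ 0 := Complex.ofReal_ne_zero.2 ht.ne'
  have e : t ^ lam = t * t ^ (lam - 1) := by
    rw [mul_comm, ← Real.rpow_add_one ht.ne', sub_add_cancel]
  rw [← re_I_mul_exp_mul_ggfG_zero_cpow h0 hφ, mehlerKernel_eq_ggfG h0 hφ ht, ggfResidualIntegrand,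
    ← Complex.re_mul_ofReal, ← Complex.re_mul_ofReal, ← Complex.re_mul_ofReal, ← Complex.sub_re, e,
    ggfF]
  congr 1
  push_cast
  field_simp

theorem integrableOn_ggfResidualIntegrand {lam ν φ : ℝ} (hlam : 0 < lam) (hν : 0 ≤ ν)
    (h0 : 0 < φ) (hφ : φ < Real.pi) :
    MeasureTheory.IntegrableOn (ggfResidualIntegrand lam ν φ) (Set.Ioi 0) := by
  have h1 := ((integrableOn_mehlerKernel_vertical (N := ν + lam) hlam (by linarith) hφ h0
    le_rfl).const_mul Complex.I).re
  have h2 := (integrableOn_rpow_sub_one_mul_exp (N := ν + lam) hlam (by linarith)).const_mul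
    (Real.sin φ ^ (lam - 1) * Real.cos ((ν + lam) * φ - lam * Real.pi / 2))
  exact MeasureTheory.IntegrableOn.congr_fun (h1.sub h2)
    (fun t ht => (ggfResidualIntegrand_eq h0 hφ ht).symm) measurableSet_Ioi

theorem integral_ggfResidualIntegrand {lam ν φ : ℝ} (hlam : 0 < lam) (hν : 0 ≤ ν)
    (h0 : 0 < φ) (hφ : φ < Real.pi) :
    ∫ t in Set.Ioi (0 : ℝ), ggfResidualIntegrand lam ν φ t =
      (∫ θ in Set.Ioo 0 φ, Real.cos ((ν + lam) * θ) * (Real.cos θ - Real.cos φ) ^ (lam - 1)) -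
        Real.sin φ ^ (lam - 1) * Real.cos ((ν + lam) * φ - lam * Real.pi / 2) *
          (Real.Gamma lam / (ν + lam) ^ lam) := by
  have hN : 0 < ν + lam := by linarith
  have i1 := (integrableOn_mehlerKernel_vertical (N := ν + lam) hlam (by linarith) hφ h0
    le_rfl).const_mul Complex.I
  have i1' : MeasureTheory.IntegrableOn (fun t : ℝ => (Complex.I *
      mehlerKernel lam (ν + lam) φ ((φ : ℂ) - Complex.I * (t : ℂ))).re) (Set.Ioi 0) := i1.re
  have i2 := (integrableOn_rpow_sub_one_mul_exp hlam hN).const_mul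
    (Real.sin φ ^ (lam - 1) * Real.cos ((ν + lam) * φ - lam * Real.pi / 2))
  rw [MeasureTheory.setIntegral_congr_fun measurableSet_Ioi
    (fun t ht => ggfResidualIntegrand_eq h0 hφ ht), MeasureTheory.integral_sub i1' i2,
    MeasureTheory.integral_const_mul, Real.integral_rpow_mul_exp_neg_mul_Ioi hlam hN, one_div,
    Real.inv_rpow hN.le]
  have h1 := re_integral_mehlerKernel (N := ν + lam) hlam (by linarith) h0 hφ
  rw [← MeasureTheory.integral_const_mul, ← RCLike.re_eq_complex_re, ← integral_re i1] at h1
  have h2 : ∫ t in Set.Ioi (0 : ℝ), (Complex.I *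
      mehlerKernel lam (ν + lam) φ ((φ : ℂ) - Complex.I * (t : ℂ))).re =
      ∫ θ in Set.Ioo 0 φ, Real.cos ((ν + lam) * θ) * (Real.cos θ - Real.cos φ) ^ (lam - 1) := by
    refine Eq.trans h1.symm ?_
    rw [intervalIntegral.integral_of_le h0.le, MeasureTheory.integral_Ioc_eq_integral_Ioo,
      ← integral_re ((integrableOn_mehlerKernel_ofReal hlam h0 hφ).mono_set Set.Ioo_subset_Icc_self)]
    refine MeasureTheory.setIntegral_congr_fun measurableSet_Ioo fun θ hθ => ?_
    simp only [RCLike.re_eq_complex_re]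
    rw [mehlerKernel_ofReal (Real.cos_le_cos_of_nonneg_of_le_pi hθ.1.le hφ.le hθ.2.le),
      Complex.re_mul_ofReal, Complex.exp_ofReal_mul_I_re, Real.cos_neg]
  rw [h2]
  ring

theorem sin_rpow_mul_rightGGF {lam ν φ : ℝ} (hlam : 0 < lam) (hν : 0 ≤ ν)
    (h0 : 0 < φ) (hφ : φ < Real.pi) :
    Real.sin φ ^ lam * rightGGF lam ν (Real.cos φ) =
      2 ^ lam * Real.Gamma (lam + 1 / 2) / (Real.sqrt Real.pi * (ν + lam) ^ lam)
          * Real.cos ((ν + lam) * φ - lam * Real.pi / 2) + ggfResidual lam ν φ := by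
  have hs := Real.sin_pos_of_pos_of_lt_pi h0 hφ
  rw [ggfResidual, integral_ggfResidualIntegrand hlam hν h0 hφ,
    integral_cos_mul_cos_sub_cos_rpow hlam hν h0 hφ]
  have e1 : Real.sin φ ^ lam = Real.sin φ ^ (1 - lam) * Real.sin φ ^ (2 * lam - 1) := by
    rw [← Real.rpow_add hs]; congr 1; ring
  have e2 : Real.sin φ ^ (1 - lam) * Real.sin φ ^ (lam - 1) = 1 := by
    rw [← Real.rpow_add hs]; simp
  have hG : Real.Gamma (lam + 1 / 2) ≠ 0 := (Real.Gamma_pos_of_pos (by positivity)).ne'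
  have hG' : Real.Gamma lam ≠ 0 := (Real.Gamma_pos_of_pos hlam).ne'
  have hp : Real.sqrt Real.pi ≠ 0 := (Real.sqrt_pos.2 Real.pi_pos).ne'
  have h2 : (2 : ℝ) ^ lam ≠ 0 := (Real.rpow_pos_of_pos two_pos _).ne'
  have hN : (ν + lam) ^ lam ≠ 0 := (Real.rpow_pos_of_pos (by linarith) _).ne'
  rw [e1]
  generalize Real.cos ((ν + lam) * φ - lam * Real.pi / 2) = B
  generalize Real.Gamma (lam + 1 / 2) = A at *
  field_simp
  linear_combination B * 2 ^ lam * A * e2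

/-! ### Bounds for the residual -/

theorem sinh_le_mul_exp (x : ℝ) : Real.sinh x ≤ x * Real.exp x := by
  have h1 := Real.add_one_le_exp (-(2 * x))
  have h2 : Real.exp (-x) = Real.exp x * Real.exp (-(2 * x)) := by
    rw [← Real.exp_add]; congr 1; ring
  rw [Real.sinh_eq, h2]
  nlinarith [Real.exp_pos x]

theorem cosh_sub_one_le {t : ℝ} (ht : 0 ≤ t) : Real.cosh t - 1 ≤ t ^ 2 / 2 * Real.exp t := by
  have h1 := sinh_le_mul_exp (t / 2)
  have h2 := Real.cosh_two_mul (t / 2)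
  have h3 := Real.cosh_sq (t / 2)
  have h4 : Real.exp t = Real.exp (t / 2) ^ 2 := by
    rw [sq, ← Real.exp_add]; congr 1; ring
  rw [show 2 * (t / 2) = t by ring] at h2
  have h5 : 0 ≤ Real.sinh (t / 2) := Real.sinh_nonneg_iff.2 (by linarith)
  have h6 := pow_le_pow_left₀ h5 h1 2
  rw [h2, h3, h4]
  nlinarith

theorem sinh_sub_self_le {t : ℝ} (ht : 0 ≤ t) : Real.sinh t - t ≤ t ^ 3 / 2 * Real.exp t := by
  have h1 : Real.sinh t ≤ t * Real.cosh t := by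
    have hmono : MonotoneOn (fun x => x * Real.cosh x - Real.sinh x) (Set.Ici 0) := by
      refine monotoneOn_of_deriv_nonneg (convex_Ici 0) (by fun_prop) (by fun_prop) fun x hx => ?_
      rw [interior_Ici] at hx
      have hd : HasDerivAt (fun x => x * Real.cosh x - Real.sinh x) (x * Real.sinh x) x :=
        (((hasDerivAt_id x).mul (Real.hasDerivAt_cosh x)).sub (Real.hasDerivAt_sinh x)).congr_deriv
          (by simp)
      rw [hd.deriv]
      exact mul_nonneg (le_of_lt hx) (Real.sinh_nonneg_iff.2 (le_of_lt hx))
    have := hmono (Set.mem_Ici.2 le_rfl) (Set.mem_Ici.2 ht) ht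
    simp at this
    linarith
  have h2 := mul_le_mul_of_nonneg_left (cosh_sub_one_le ht) ht
  nlinarith

/-- Mean value inequality for a power on the half-plane `re z ≥ 1`, where `1 ≤ ‖z‖`. -/
theorem norm_cpow_sub_one_le {w : ℂ} (hw : 1 ≤ w.re) {μ C : ℝ}
    (hC : ∀ r, 1 ≤ r → r ≤ ‖w‖ → r ^ (μ - 1) ≤ C) :
    ‖w ^ (μ : ℂ) - 1‖ ≤ |μ| * C * ‖w - 1‖ := by
  set s : Set ℂ := {z | 1 ≤ z.re} ∩ Metric.closedBall 0 ‖w‖ with hs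
  have hconv : Convex ℝ s := (convex_halfSpace_re_ge 1).inter (convex_closedBall 0 _)
  have hw1 : 1 ≤ ‖w‖ := hw.trans (Complex.re_le_norm w)
  have hd (z : ℂ) (hz : z ∈ s) :
      HasDerivWithinAt (fun z : ℂ => z ^ (μ : ℂ)) (μ * z ^ ((μ : ℂ) - 1)) s z := by
    have hz1 : 1 ≤ z.re := hz.1
    exact ((hasDerivAt_id z).cpow_const (c := (μ : ℂ))
      (Or.inl (by simpa using one_pos.trans_le hz1))).hasDerivWithinAt.congr_deriv (by simp)
  have hb (z : ℂ) (hz : z ∈ s) : ‖(μ : ℂ) * z ^ ((μ : ℂ) - 1)‖ ≤ |μ| * C := by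
    have e : (μ : ℂ) - 1 = ((μ - 1 : ℝ) : ℂ) := by push_cast; rfl
    rw [norm_mul, e, Complex.norm_cpow_real, Complex.norm_real, Real.norm_eq_abs]
    have hz1 : 1 ≤ z.re := hz.1
    exact mul_le_mul_of_nonneg_left (hC _ (hz1.trans (Complex.re_le_norm z))
      (by simpa using hz.2)) (abs_nonneg _)
  have := hconv.norm_image_sub_le_of_norm_hasDerivWithin_le hd hb (x := 1) (y := w)
    ⟨by simp, by simpa using hw1⟩ ⟨hw, by simp⟩
  simpa using this

/-- The quotient `g(φ, t) / g(φ, 0) = sinh t / t - i cot φ (cosh t - 1) / t`, for `t ≠ 0`, given by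
its real and imaginary parts. -/
noncomputable def ggfRatio (φ t : ℝ) : ℂ :=
  ⟨Real.sinh t / t, -(Real.cot φ * ((Real.cosh t - 1) / t))⟩

theorem one_le_ggfRatio_re (φ : ℝ) {t : ℝ} (ht : 0 < t) : 1 ≤ (ggfRatio φ t).re := by
  rw [ggfRatio, one_le_div ht]
  exact Real.self_le_sinh_iff.2 ht.le

theorem ggfG_eq_mul_ggfRatio {φ t : ℝ} (hs : Real.sin φ ≠ 0) (ht : t ≠ 0) :
    ggfG φ t = (Real.sin φ : ℂ) * (Complex.I * ggfRatio φ t) := by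
  have h : (t : ℂ) ≠ 0 := Complex.ofReal_ne_zero.2 ht
  apply mul_left_cancel₀ h
  rw [ofReal_mul_ggfG φ ht]
  apply Complex.ext
  · rw [Complex.sub_re, cos_sub_I_mul_re, ← Complex.ofReal_cos]
    simp [ggfRatio, Real.cot_eq_cos_div_sin, -Complex.ofReal_sin, -Complex.ofReal_cos]
    field_simp
  · rw [Complex.sub_im, cos_sub_I_mul_im, ← Complex.ofReal_cos]
    simp [ggfRatio, -Complex.ofReal_sin, -Complex.ofReal_cos]
    field_simp

theorem norm_ggfRatio_sub_one_le (φ : ℝ) {t : ℝ} (ht : 0 < t) :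
    ‖ggfRatio φ t - 1‖ ≤ t * (|Real.cot φ| + 2 / 3 * t) * Real.exp t := by
  have h1 : (Real.cosh t - 1) / t ≤ t / 2 * Real.exp t := by
    rw [div_le_iff₀ ht]
    linarith [cosh_sub_one_le ht.le]
  have h2 : Real.sinh t / t - 1 ≤ t ^ 2 / 2 * Real.exp t := by
    rw [div_sub_one ht.ne', div_le_iff₀ ht]
    linarith [sinh_sub_self_le ht.le]
  have h3 : 0 ≤ (Real.cosh t - 1) / t := div_nonneg (by linarith [Real.one_le_cosh t]) ht.le
  have h4 := one_le_ggfRatio_re φ ht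
  have hre : |(ggfRatio φ t - 1).re| = Real.sinh t / t - 1 := by
    rw [Complex.sub_re, Complex.one_re, abs_of_nonneg (by linarith)]; rfl
  have him : |(ggfRatio φ t - 1).im| = |Real.cot φ| * ((Real.cosh t - 1) / t) := by
    rw [Complex.sub_im, Complex.one_im, sub_zero, ← abs_of_nonneg h3, ← abs_mul, ← abs_neg]
    simp [ggfRatio]
  refine (Complex.norm_le_abs_re_add_abs_im _).trans ?_
  rw [hre, him]
  have h5 := mul_le_mul_of_nonneg_left h1 (abs_nonneg (Real.cot φ))
  have h6 := mul_nonneg (mul_nonneg (abs_nonneg (Real.cot φ)) ht.le) (Real.exp_pos t).le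
  have h7 := mul_nonneg (sq_nonneg t) (Real.exp_pos t).le
  nlinarith

theorem norm_ggfRatio_sq_le (φ : ℝ) {t : ℝ} (ht : 0 < t) :
    ‖ggfRatio φ t‖ ^ 2 ≤ Real.exp t ^ 2 * (1 + (|Real.cot φ| * t / 2) ^ 2) := by
  have h1 : (Real.cosh t - 1) / t ≤ t / 2 * Real.exp t := by
    rw [div_le_iff₀ ht]
    linarith [cosh_sub_one_le ht.le]
  have h2 : Real.sinh t / t ≤ Real.exp t := by
    rw [div_le_iff₀ ht]
    linarith [sinh_le_mul_exp t]
  have h3 : 0 ≤ (Real.cosh t - 1) / t := div_nonneg (by linarith [Real.one_le_cosh t]) ht.le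
  have h4 : 0 ≤ Real.sinh t / t := zero_le_one.trans (one_le_ggfRatio_re φ ht)
  have h5 := pow_le_pow_left₀ h4 h2 2
  have h6 := mul_le_mul_of_nonneg_left (pow_le_pow_left₀ h3 h1 2) (sq_nonneg (Real.cot φ))
  have h7 : (|Real.cot φ| * t / 2) ^ 2 = Real.cot φ ^ 2 * (t / 2) ^ 2 := by
    rw [mul_div_assoc, mul_pow, sq_abs]
  rw [Complex.sq_norm, Complex.normSq_apply, h7]
  change Real.sinh t / t * (Real.sinh t / t) +
    -(Real.cot φ * ((Real.cosh t - 1) / t)) * -(Real.cot φ * ((Real.cosh t - 1) / t)) ≤ _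
  nlinarith

/-- Growth of the ratio for `lam ≥ 2`: `‖w‖² ≤ e ^ (2 t) (1 + y²)` with `y = |cot φ| t / 2`, and
`(1 + y²)^p ≤ 2^p (1 + y^(2 p))` for `p = lam / 2 - 1 ≥ 0`. -/
theorem norm_ggfRatio_rpow_le (φ : ℝ) {t lam : ℝ} (ht : 0 < t) (hlam : 2 ≤ lam) :
    ‖ggfRatio φ t‖ ^ (lam - 2) ≤ 2 ^ (lam / 2) * Real.exp ((lam - 2) * t) *
      (1 + 2 ^ (2 - lam) * |Real.cot φ| ^ (lam - 2) * t ^ (lam - 2)) := by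
  set y := |Real.cot φ| * t / 2 with hy
  have hy0 : 0 ≤ y := by positivity
  have hp : 0 ≤ (lam - 2) / 2 := by linarith
  have e0 {x : ℝ} (hx : 0 ≤ x) : x ^ (lam - 2) = (x ^ 2) ^ ((lam - 2) / 2) := by
    rw [← Real.rpow_natCast, ← Real.rpow_mul hx]; congr 1; push_cast; ring
  have e1 : y ^ (lam - 2) = 2 ^ (2 - lam) * |Real.cot φ| ^ (lam - 2) * t ^ (lam - 2) := by
    rw [hy, Real.div_rpow (by positivity) two_pos.le, Real.mul_rpow (abs_nonneg _) ht.le,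
      show (2 : ℝ) - lam = -(lam - 2) by ring, Real.rpow_neg two_pos.le]
    field_simp
  have e2 : (1 + y ^ 2) ^ ((lam - 2) / 2) ≤ 2 ^ ((lam - 2) / 2) * (1 + y ^ (lam - 2)) := by
    have h1 : (1 + y ^ 2) ^ ((lam - 2) / 2) ≤ (2 * max 1 (y ^ 2)) ^ ((lam - 2) / 2) := by
      refine Real.rpow_le_rpow (by positivity) ?_ hp
      linarith [le_max_left 1 (y ^ 2), le_max_right 1 (y ^ 2)]
    refine h1.trans ?_
    rw [Real.mul_rpow two_pos.le (by positivity)]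
    gcongr
    rw [e0 hy0]
    rcases max_choice 1 (y ^ 2) with h | h <;> rw [h]
    · rw [Real.one_rpow]; linarith [Real.rpow_nonneg (sq_nonneg y) ((lam - 2) / 2)]
    · linarith
  have e3 : (2 : ℝ) ^ ((lam - 2) / 2) ≤ 2 ^ (lam / 2) :=
    Real.rpow_le_rpow_of_exponent_le one_le_two (by linarith)
  have e4 : (Real.exp t ^ 2) ^ ((lam - 2) / 2) = Real.exp ((lam - 2) * t) := by
    rw [← e0 (Real.exp_pos t).le, ← Real.exp_mul, mul_comm]
  calc ‖ggfRatio φ t‖ ^ (lam - 2) = (‖ggfRatio φ t‖ ^ 2) ^ ((lam - 2) / 2) := e0 (norm_nonneg _)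
    _ ≤ (Real.exp t ^ 2 * (1 + y ^ 2)) ^ ((lam - 2) / 2) :=
      Real.rpow_le_rpow (by positivity) (norm_ggfRatio_sq_le φ ht) hp
    _ = Real.exp ((lam - 2) * t) * (1 + y ^ 2) ^ ((lam - 2) / 2) := by
      rw [Real.mul_rpow (by positivity) (by positivity), e4]
    _ ≤ Real.exp ((lam - 2) * t) * (2 ^ (lam / 2) * (1 + y ^ (lam - 2))) := by
      gcongr
      exact e2.trans (mul_le_mul_of_nonneg_right e3 (by positivity))
    _ = _ := by rw [e1]; ring

/-- The integral of `(κ + 2 t / 3) t ^ a e^{-m t}` over the half-line, in terms of `Γ`. -/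
theorem integral_add_mul_rpow_mul_exp {a m : ℝ} (κ : ℝ) (ha : 0 < a + 1) (hm : 0 < m) :
    MeasureTheory.IntegrableOn (fun t => (κ + 2 / 3 * t) * t ^ a * Real.exp (-(m * t)))
      (Set.Ioi 0) ∧
    ∫ t in Set.Ioi (0 : ℝ), (κ + 2 / 3 * t) * t ^ a * Real.exp (-(m * t)) =
      Real.Gamma (a + 1) / m ^ (a + 1) * (κ + 2 / 3 * ((a + 1) / m)) := by
  have ha2 : 0 < a + 1 + 1 := by linarith
  have i1 := (integrableOn_rpow_sub_one_mul_exp ha hm).const_mul κ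
  have i2 := (integrableOn_rpow_sub_one_mul_exp ha2 hm).const_mul (2 / 3)
  have e : ∀ t ∈ Set.Ioi (0 : ℝ), (κ + 2 / 3 * t) * t ^ a * Real.exp (-(m * t)) =
      κ * (t ^ (a + 1 - 1) * Real.exp (-(m * t))) +
        2 / 3 * (t ^ (a + 1 + 1 - 1) * Real.exp (-(m * t))) := by
    intro t ht
    rw [add_sub_cancel_right, add_sub_cancel_right, Real.rpow_add_one (ne_of_gt ht)]
    ring
  refine ⟨MeasureTheory.IntegrableOn.congr_fun (i1.add i2) (fun t ht => (e t ht).symm)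
    measurableSet_Ioi, ?_⟩
  rw [MeasureTheory.setIntegral_congr_fun measurableSet_Ioi e, MeasureTheory.integral_add i1 i2,
    MeasureTheory.integral_const_mul, MeasureTheory.integral_const_mul,
    Real.integral_rpow_mul_exp_neg_mul_Ioi ha hm, Real.integral_rpow_mul_exp_neg_mul_Ioi ha2 hm,
    one_div, Real.inv_rpow hm.le, Real.inv_rpow hm.le, Real.Gamma_add_one ha.ne',
    Real.rpow_add_one hm.ne' (a + 1)]
  field_simp

/-- For `w` in the right half-plane the arguments of `i` and `w` add up to less than `π`, so that the
principal power is multiplicative. -/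
theorem I_mul_cpow {w : ℂ} (hw : 0 < w.re) (s : ℂ) :
    (Complex.I * w) ^ s = Complex.I ^ s * w ^ s := by
  have hw0 : w ≠ 0 := by rintro rfl; simp at hw
  have harg := abs_lt.1 (Complex.abs_arg_lt_pi_div_two_iff.2 (Or.inl hw))
  have hlog : Complex.log (Complex.I * w) = Complex.log Complex.I + Complex.log w := by
    rw [Complex.log_mul_eq_add_log_iff Complex.I_ne_zero hw0, Complex.arg_I]
    constructor <;> linarith [Real.pi_pos]
  rw [Complex.cpow_def_of_ne_zero (mul_ne_zero Complex.I_ne_zero hw0),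
    Complex.cpow_def_of_ne_zero Complex.I_ne_zero, Complex.cpow_def_of_ne_zero hw0, hlog, add_mul,
    Complex.exp_add]

theorem norm_ggfF {lam φ t : ℝ} (hs : 0 < Real.sin φ) (ht : 0 < t) :
    ‖ggfF lam φ t‖ =
      Real.sin φ ^ (lam - 1) * ‖ggfRatio φ t ^ ((lam - 1 : ℝ) : ℂ) - 1‖ / t := by
  have hre := one_le_ggfRatio_re φ ht
  have hw : ggfRatio φ t ≠ 0 := by
    intro h; rw [h] at hre; simp at hre; linarith
  have e : (lam : ℂ) - 1 = ((lam - 1 : ℝ) : ℂ) := by push_cast; rfl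
  have hg : ggfG φ 0 = (Real.sin φ : ℂ) * Complex.I := by simp [ggfG, mul_comm]
  have hI : ‖Complex.I ^ ((lam - 1 : ℝ) : ℂ)‖ = 1 := by
    rw [Complex.norm_cpow_real, Complex.norm_I, Real.one_rpow]
  have hsn : ‖((Real.sin φ : ℝ) : ℂ) ^ ((lam - 1 : ℝ) : ℂ)‖ = Real.sin φ ^ (lam - 1) := by
    rw [Complex.norm_cpow_real, Complex.norm_real, Real.norm_of_nonneg hs.le]
  rw [ggfF, hg, ggfG_eq_mul_ggfRatio hs.ne' ht.ne', e,
    ofReal_mul_cpow hs (mul_ne_zero Complex.I_ne_zero hw), ofReal_mul_cpow hs Complex.I_ne_zero,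
    I_mul_cpow (by linarith), ← mul_sub, ← mul_sub_one, norm_div, norm_mul, norm_mul, hI, hsn,
    Complex.norm_real, Real.norm_of_nonneg ht.le, one_mul]

/-- Pointwise bound of the residual integrand, with `C` a bound for the factor `|z|^(lam - 2)` of the
mean value inequality. -/
theorem abs_ggfResidualIntegrand_le {lam ν φ t : ℝ} (hs : 0 < Real.sin φ) (ht : 0 < t) {C : ℝ}
    (hC : ∀ r, 1 ≤ r → r ≤ ‖ggfRatio φ t‖ → r ^ (lam - 1 - 1) ≤ C) :
    |ggfResidualIntegrand lam ν φ t| ≤ Real.sin φ ^ (lam - 1) * (|lam - 1| * C *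
      ((|Real.cot φ| + 2 / 3 * t) * t ^ lam * Real.exp (-((ν + lam - 1) * t)))) := by
  have hre := one_le_ggfRatio_re φ ht
  have hC0 : 0 ≤ C := by
    have := hC 1 le_rfl (hre.trans (Complex.re_le_norm _))
    rw [Real.one_rpow] at this
    linarith
  have h1 : |(Complex.I * Complex.exp (-(Complex.I * ((ν : ℂ) + (lam : ℂ)) * (φ : ℂ))) *
      ggfF lam φ t).re| ≤ ‖ggfF lam φ t‖ := by
    refine (Complex.abs_re_le_norm _).trans_eq ?_
    rw [norm_mul, norm_mul, Complex.norm_I, Complex.norm_exp]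
    simp
  have h2 := (norm_cpow_sub_one_le hre hC).trans
    (mul_le_mul_of_nonneg_left (norm_ggfRatio_sub_one_le φ ht) (by positivity))
  have h3 : Real.exp (-((ν + lam - 1) * t)) = Real.exp t * Real.exp (-((ν + lam) * t)) := by
    rw [← Real.exp_add]; congr 1; ring
  rw [ggfResidualIntegrand, abs_mul, abs_mul, abs_of_pos (Real.exp_pos _),
    abs_of_nonneg (Real.rpow_nonneg ht.le lam)]
  calc _ ≤ ‖ggfF lam φ t‖ * t ^ lam * Real.exp (-((ν + lam) * t)) := by gcongr
    _ = Real.sin φ ^ (lam - 1) * ‖ggfRatio φ t ^ ((lam - 1 : ℝ) : ℂ) - 1‖ *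
        (t ^ lam * Real.exp (-((ν + lam) * t)) / t) := by
      rw [norm_ggfF hs ht]; field_simp
    _ ≤ Real.sin φ ^ (lam - 1) * (|lam - 1| * C * (t * (|Real.cot φ| + 2 / 3 * t) * Real.exp t)) *
        (t ^ lam * Real.exp (-((ν + lam) * t)) / t) := by gcongr
    _ = _ := by rw [h3]; field_simp

theorem abs_ggfResidual_le {lam ν φ : ℝ} (hlam : 0 < lam) (hs : 0 < Real.sin φ) {b : ℝ → ℝ}
    (hb : MeasureTheory.IntegrableOn b (Set.Ioi 0))
    (h : ∀ t, 0 < t → |ggfResidualIntegrand lam ν φ t| ≤ Real.sin φ ^ (lam - 1) * b t) :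
    |ggfResidual lam ν φ| ≤ 2 ^ lam * Real.Gamma (lam + 1 / 2) /
      (Real.sqrt Real.pi * Real.Gamma lam) * ∫ t in Set.Ioi (0 : ℝ), b t := by
  have hK : 0 ≤ 2 ^ lam * Real.Gamma (lam + 1 / 2) / (Real.sqrt Real.pi * Real.Gamma lam) := by
    have := Real.Gamma_pos_of_pos hlam
    have := Real.Gamma_pos_of_pos (by positivity : 0 < lam + 1 / 2)
    positivity
  have h1 := MeasureTheory.norm_integral_le_of_norm_le
    (f := ggfResidualIntegrand lam ν φ) (hb.const_mul (Real.sin φ ^ (lam - 1)))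
    ((MeasureTheory.ae_restrict_iff' measurableSet_Ioi).2 (Filter.Eventually.of_forall h))
  rw [MeasureTheory.integral_const_mul, Real.norm_eq_abs] at h1
  have h2 : Real.sin φ ^ (1 - lam) * Real.sin φ ^ (lam - 1) = 1 := by
    rw [← Real.rpow_add hs]; simp
  rw [ggfResidual, abs_mul, abs_mul, abs_of_nonneg hK, abs_of_nonneg (Real.rpow_nonneg hs.le _),
    mul_assoc]
  refine mul_le_mul_of_nonneg_left ?_ hK
  refine (mul_le_mul_of_nonneg_left h1 (Real.rpow_nonneg hs.le _)).trans_eq ?_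
  rw [← mul_assoc, h2, one_mul]

theorem abs_ggfResidual_le_small {lam ν φ : ℝ} (hlam : 0 < lam) (hlam2 : lam ≤ 2)
    (hN : 1 < ν + lam) (hs : 0 < Real.sin φ) :
    |ggfResidual lam ν φ| ≤ ggfBoundSmall lam ν φ := by
  have hm : 0 < ν + lam - 1 := by linarith
  obtain ⟨i1, e1⟩ := integral_add_mul_rpow_mul_exp |Real.cot φ| (by linarith : 0 < lam + 1) hm
  have h := abs_ggfResidual_le (ν := ν) hlam hs (i1.const_mul |lam - 1|) fun t ht => by
    have := abs_ggfResidualIntegrand_le (ν := ν) hs ht (lam := lam) (C := 1)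
      fun r hr _ => Real.rpow_le_one_of_one_le_of_nonpos hr (by linarith)
    rwa [mul_one] at this
  refine h.trans_eq ?_
  rw [MeasureTheory.integral_const_mul, e1, ggfBoundSmall, Real.Gamma_add_one hlam.ne']
  have hG : Real.Gamma lam ≠ 0 := (Real.Gamma_pos_of_pos hlam).ne'
  generalize Real.Gamma (lam + 1 / 2) = A
  field_simp

theorem abs_ggfResidual_le_large {lam ν φ : ℝ} (hlam : 2 < lam) (hν : 0 ≤ ν) (hN : lam - 3 < ν)
    (hs : 0 < Real.sin φ) :
    |ggfResidual lam ν φ| ≤ ggfBoundLarge lam ν φ := by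
  have hlam0 : 0 < lam := by linarith
  have hm : 0 < ν + 1 := by linarith
  have hm' : 0 < ν - lam + 3 := by linarith
  set κ := |Real.cot φ| with hκ
  obtain ⟨i1, e1⟩ := integral_add_mul_rpow_mul_exp κ (by linarith : 0 < lam + 1) hm
  obtain ⟨i2, e2⟩ := integral_add_mul_rpow_mul_exp κ (by linarith : 0 < 2 * lam - 2 + 1) hm'
  have h := abs_ggfResidual_le (ν := ν) hlam0 hs
    ((i1.add (i2.const_mul (2 ^ (2 - lam) * κ ^ (lam - 2)))).const_mul
      ((lam - 1) * 2 ^ (lam / 2))) fun t ht => by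
    have hw := norm_ggfRatio_rpow_le φ ht hlam.le
    have h1 := abs_ggfResidualIntegrand_le (ν := ν) hs ht (lam := lam)
      (C := 2 ^ (lam / 2) * Real.exp ((lam - 2) * t) *
        (1 + 2 ^ (2 - lam) * κ ^ (lam - 2) * t ^ (lam - 2)))
      fun r hr hr' => by
        rw [show lam - 1 - 1 = lam - 2 by ring]
        exact (Real.rpow_le_rpow (by linarith) hr' (by linarith)).trans hw
    refine h1.trans (mul_le_mul_of_nonneg_left ?_ (Real.rpow_nonneg hs.le _))
    have x1 : Real.exp ((lam - 2) * t) * Real.exp (-((ν + lam - 1) * t)) =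
        Real.exp (-((ν + 1) * t)) := by
      rw [← Real.exp_add]; congr 1; ring
    have x2 : Real.exp (-((ν + 1) * t)) ≤ Real.exp (-((ν - lam + 3) * t)) :=
      Real.exp_le_exp.2 (by nlinarith)
    have x3 : t ^ lam * t ^ (lam - 2) = t ^ (2 * lam - 2) := by
      rw [← Real.rpow_add ht]; congr 1; ring
    rw [abs_of_pos (by linarith : 0 < lam - 1), ← hκ]
    simp only [Pi.add_apply]
    calc _ = (lam - 1) * 2 ^ (lam / 2) * ((κ + 2 / 3 * t) * t ^ lam * Real.exp (-((ν + 1) * t)) +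
          2 ^ (2 - lam) * κ ^ (lam - 2) * ((κ + 2 / 3 * t) * t ^ (2 * lam - 2) *
            Real.exp (-((ν + 1) * t)))) := by
          rw [← x1, ← x3]; ring
      _ ≤ _ := by
          have : 0 ≤ lam - 1 := by linarith
          gcongr
  refine h.trans_eq ?_
  rw [MeasureTheory.integral_const_mul]
  have hadd := MeasureTheory.integral_add i1 (i2.const_mul (2 ^ (2 - lam) * κ ^ (lam - 2)))
  simp only [Pi.add_apply]
  rw [hadd, MeasureTheory.integral_const_mul, e1, e2, ggfBoundLarge, ← hκ,
    show 2 * lam - 2 + 1 = 2 * lam - 1 by ring, Real.Gamma_add_one hlam0.ne']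
  have hG : Real.Gamma lam ≠ 0 := (Real.Gamma_pos_of_pos hlam0).ne'
  have h2 : (2 : ℝ) ^ (3 * lam / 2) = 2 ^ lam * 2 ^ (lam / 2) := by
    rw [← Real.rpow_add two_pos]; congr 1; ring
  have hp1 : (ν + 1) ^ (lam + 1) ≠ 0 := (Real.rpow_pos_of_pos hm _).ne'
  have hp2 : (ν - lam + 3) ^ (2 * lam - 1) ≠ 0 := (Real.rpow_pos_of_pos hm' _).ne'
  rw [h2]
  generalize Real.Gamma (lam + 1 / 2) = A
  generalize (ν + 1) ^ (lam + 1) = P at *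
  generalize (ν - lam + 3) ^ (2 * lam - 1) = Q at *
  generalize (2 : ℝ) ^ (2 - lam) = R
  generalize (2 : ℝ) ^ (lam / 2) = U
  generalize Real.Gamma (2 * lam - 1) = V
  generalize κ ^ (lam - 2) = X
  field_simp

theorem mainTheorem1 (lam ν φ : ℝ) (hlam : 0 < lam) (hν : 0 ≤ ν)
    (hφ : φ ∈ Set.Ioo 0 Real.pi) :
    MeasureTheory.IntegrableOn (ggfResidualIntegrand lam ν φ) (Set.Ioi 0) ∧
    Real.sin φ ^ lam * rightGGF lam ν (Real.cos φ)
      = 2 ^ lam * Real.Gamma (lam + 1 / 2) / (Real.sqrt Real.pi * (ν + lam) ^ lam)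
          * Real.cos ((ν + lam) * φ - lam * Real.pi / 2)
        + ggfResidual lam ν φ ∧
    (0 < ν → (lam ≤ 2 ∧ 1 < ν + lam) ∨ (2 < lam ∧ lam - 3 < ν) →
      |ggfResidual lam ν φ| ≤ ggfBound lam ν φ) := by
  have hs := Real.sin_pos_of_pos_of_lt_pi hφ.1 hφ.2
  refine ⟨integrableOn_ggfResidualIntegrand hlam hν hφ.1 hφ.2,
    sin_rpow_mul_rightGGF hlam hν hφ.1 hφ.2, fun _ h => ?_⟩
  rcases h with ⟨h2, hN⟩ | ⟨h2, hN⟩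
  · rw [ggfBound, if_pos h2]
    exact abs_ggfResidual_le_small hlam h2 hN hs
  · rw [ggfBound, if_neg h2.not_ge]
    exact abs_ggfResidual_le_large h2 hν hN hs
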